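/- **Theorem (Sharp regularity estimates at extremum points).** Let $n$ be a dimension, $p\in(1,\infty)$, $\theta\in(0,\infty)$, $\sigma\in(\theta,1+\theta)$. Write $B_r(x_0)$ for open balls of $\mathbb R^n$ and $B_1=B_1(0)$. Let $\mathfrak B\in C^0(\overline{B_1};\mathbb R^n)$, $\varrho\in C^0(\overline{B_1})$, let $f$ be bounded and continuous on $B_1$, and let $u\in C^0(B_1)$ be a bounded viscosity solution of $$|\nabla u|^{\theta}\Delta_p^{\mathrm N}u+\langle \mathfrak B(x),\nabla u\rangle|\nabla u|^{\theta}+\varrho(x)|\nabla u|^{\sigma}=f(x)\quad\text{in }B_1,\qquad \Delta_p^{\mathrm N}u=\Delta u+(p-2)\Big\langle D^2u\,\tfrac{\nabla u}{|\nabla u|},\tfrac{\nabla u}{|\nabla u|}\Big\rangle .$$ Let $x_0\in B_1$ be a local extremum point of $u$, and let $\delta>0$ be any radius such that $B_\delta(x_0)\subset B_1$ and $u(x_0)$ is the minimum or the maximum of $u$ over $B_\delta(x_0)$. Then, for all $r\in(0,1/2)$, $$\sup_{x\in B_r(x_0)\cap B_1}|u(x)-u(x_0)|\le C\Big(\|u\|_{L^\infty(B_1)}+\|\varrho\|_{L^\infty(B_1)}^{\frac1{1+\theta-\sigma}}+\|f\|_{L^\infty(B_1)}^{\frac1{1+\theta}}\Big)\Big(\frac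 r\delta\Big)^{1+\frac1{1+\theta}},$$ where $C>0$ depends only on $n,p,\theta,\sigma$ and an upper bound for $\|\mathfrak B\|_{L^\infty(B_1;\mathbb R^n)}$. Here $u$ is a viscosity subsolution (supersolution) if, whenever $\varphi\in C^2(B_1)$ and $u-\varphi$ has a local maximum (minimum) at $y\in B_1$: (i) if $\nabla\varphi(y)\ne0$, then $|\nabla\varphi(y)|^{\theta}\Delta_p^{\mathrm N}\varphi(y)+\langle\mathfrak B(y),\nabla\varphi(y)\rangle|\nabla\varphi(y)|^{\theta}+\varrho(y)|\nabla\varphi(y)|^\sigma\ge f(y)$ (respectively $\le f(y)$); (ii) if $\nabla\varphi(y)=0$, then $\kappa\,\big(\Delta\varphi(y)+(p-2)\Lambda\big)\ge f(y)$ (respectively $\le f(y)$), where $\Lambda$ is the largest (respectively smallest) eigenvalue of $D^2\varphi(y)$ if $p\ge2$ and the smallest (respectively largest) one if $1<p<2$. The theorem holds for both usual conventions: $\kappa=0$ (the degenerate coefficient $|\nabla\varphi|^\theta$ is kept in (ii)) and $\kappa=1$ (it is dropped), with the same $C$. A viscosity solution is both a sub- and a supersolution. -/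

import Mathlib

namespace NormalizedPLaplace

/-- Euclidean space of dimension `n`. -/
abbrev Euc (n : ℕ) : Type := EuclideanSpace ℝ (Fin n)

/-- The open unit ball centred at the origin. -/
def unitBall (n : ℕ) : Set (Euc n) := Metric.ball 0 1

/-- The Hessian of `φ` at `x`, as a bilinear form: `hess φ x v w = ⟨D²φ(x) v, w⟩`. -/
noncomputable def hess {n : ℕ} (φ : Euc n → ℝ) (x v w : Euc n) : ℝ :=
  fderiv ℝ (fderiv ℝ φ) x v w

/-- The largest eigenvalue of the Hessian: the maximum of `⟨D²φ(x) ξ, ξ⟩` over unit vectors. -/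
noncomputable def lambdaMax {n : ℕ} (φ : Euc n → ℝ) (x : Euc n) : ℝ :=
  sSup ((fun ξ => hess φ x ξ ξ) '' Metric.sphere 0 1)

/-- The smallest eigenvalue of the Hessian: the minimum of `⟨D²φ(x) ξ, ξ⟩` over unit vectors. -/
noncomputable def lambdaMin {n : ℕ} (φ : Euc n → ℝ) (x : Euc n) : ℝ :=
  sInf ((fun ξ => hess φ x ξ ξ) '' Metric.sphere 0 1)

/-- The normalized `p`-Laplacian `Δφ + (p - 2) ⟨D²φ ν, ν⟩` with `ν = ∇φ / |∇φ|`
(used only at points where the gradient does not vanish). -/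
noncomputable def normPLap {n : ℕ} (p : ℝ) (φ : Euc n → ℝ) (x : Euc n) : ℝ :=
  Laplacian.laplacian φ x +
    (p - 2) * hess φ x (‖gradient φ x‖⁻¹ • gradient φ x) (‖gradient φ x‖⁻¹ • gradient φ x)

/-- The largest value `Δφ + (p - 2) ⟨D²φ ξ, ξ⟩` takes over unit vectors `ξ`. -/
noncomputable def upperPLap {n : ℕ} (p : ℝ) (φ : Euc n → ℝ) (x : Euc n) : ℝ :=
  Laplacian.laplacian φ x + (p - 2) * (if 2 ≤ p then lambdaMax φ x else lambdaMin φ x)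

/-- The smallest value `Δφ + (p - 2) ⟨D²φ ξ, ξ⟩` takes over unit vectors `ξ`. -/
noncomputable def lowerPLap {n : ℕ} (p : ℝ) (φ : Euc n → ℝ) (x : Euc n) : ℝ :=
  Laplacian.laplacian φ x + (p - 2) * (if 2 ≤ p then lambdaMin φ x else lambdaMax φ x)

/-- The Hamiltonian `⟨B(x), ξ⟩ |ξ|^θ + ϱ(x) |ξ|^σ`. -/
noncomputable def hamiltonian {n : ℕ} (θ σ : ℝ) (B : Euc n → Euc n) (ϱ : Euc n → ℝ)
    (ξ x : Euc n) : ℝ :=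
  inner ℝ (B x) ξ * ‖ξ‖ ^ θ + ϱ x * ‖ξ‖ ^ σ

/-- Viscosity subsolutions in `Ω` (open) of
`|∇u|^θ Δ_p^N u + ⟨B(x), ∇u⟩ |∇u|^θ + ϱ(x) |∇u|^σ = f(x)`.

The number `κ` is the weight of the second-order term at test points where `∇φ = 0`.
With `κ = 0` the coefficient `|∇φ|^θ` is kept there (it vanishes, as `θ > 0`), so the requirement
is `0 ≥ f(x₀)`; with `κ = 1` the coefficient is dropped, so the requirement is
`Δφ(x₀) + (p - 2) λ_max(D²φ(x₀)) ≥ f(x₀)` for `p ≥ 2`, and the same with `λ_min` for `p < 2`. -/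
def IsViscositySubsolution {n : ℕ} (κ p θ σ : ℝ) (B : Euc n → Euc n) (ϱ f : Euc n → ℝ)
    (Ω : Set (Euc n)) (u : Euc n → ℝ) : Prop :=
  ∀ φ : Euc n → ℝ, ContDiffOn ℝ 2 φ Ω → ∀ x₀ ∈ Ω, IsLocalMax (fun x => u x - φ x) x₀ →
    (gradient φ x₀ ≠ 0 →
      f x₀ ≤ ‖gradient φ x₀‖ ^ θ * normPLap p φ x₀ + hamiltonian θ σ B ϱ (gradient φ x₀) x₀) ∧
    (gradient φ x₀ = 0 → f x₀ ≤ κ * upperPLap p φ x₀)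

/-- Viscosity supersolutions, with the same conventions. -/
def IsViscositySupersolution {n : ℕ} (κ p θ σ : ℝ) (B : Euc n → Euc n) (ϱ f : Euc n → ℝ)
    (Ω : Set (Euc n)) (u : Euc n → ℝ) : Prop :=
  ∀ φ : Euc n → ℝ, ContDiffOn ℝ 2 φ Ω → ∀ x₀ ∈ Ω, IsLocalMin (fun x => u x - φ x) x₀ →
    (gradient φ x₀ ≠ 0 →
      ‖gradient φ x₀‖ ^ θ * normPLap p φ x₀ + hamiltonian θ σ B ϱ (gradient φ x₀) x₀ ≤ f x₀) ∧
    (gradient φ x₀ = 0 → κ * lowerPLap p φ x₀ ≤ f x₀)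

/-- Continuous viscosity solutions in `Ω`: sub- and supersolutions at once. -/
def IsViscositySolution {n : ℕ} (κ p θ σ : ℝ) (B : Euc n → Euc n) (ϱ f : Euc n → ℝ)
    (Ω : Set (Euc n)) (u : Euc n → ℝ) : Prop :=
  ContinuousOn u Ω ∧ IsViscositySubsolution κ p θ σ B ϱ f Ω u ∧
    IsViscositySupersolution κ p θ σ B ϱ f Ω u

/-- `g` is bounded on the unit ball. -/
def BoundedOnBall {n : ℕ} (g : Euc n → ℝ) : Prop := ∃ M : ℝ, ∀ x ∈ unitBall n, |g x| ≤ M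

/-- The supremum norm over the open unit ball. It is used only for functions that are continuous and
bounded there, for which it is the `L^∞` norm. -/
noncomputable def supNorm {n : ℕ} {F : Type*} [NormedAddCommGroup F] (g : Euc n → F) : ℝ :=
  ⨆ x : unitBall n, ‖g x‖

end NormalizedPLaplace

/-! At a minimum `x₀` the function is already flat to first order, so no affine function has to be
subtracted when zooming in, and the structure of the equation survives rescaling. A maximum is
treated through `-u`. Put τ = 1 + 1/(1+θ). Replacing `v` by (v(x₀ + r y) − v(x₀))/m with r
comparable to R and m to R^τ keeps the bound for `f` and does not worsen those for `B` and `ϱ`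
(`JetSuper.rescale`, `scaled_coefficient_le`). The estimate follows by iterating one improvement
step (`sub_le_of_isMinOn`): values in [0,1], small data and v(0) = 0 force v ≤ 4^(−τ) on the ball of
radius 1/4 (`exists_flatness`).

Flatness is proved directly, without compactness, so its constants depend only on the structural
parameters. If v > μ at some x in that ball, a Hölder estimate keeps v ≥ μ/2 on a ball of fixed
radius about x (`exists_holder`), and a Gaussian barrier centred at x then forces v(0) > 0
(`exists_pos_of_le_on_closedBall`).

The Hölder estimate is the Ishii–Lions argument: v(x) − v(y) is compared with L√‖x − y‖ plus a
localizing penalty. At a positive maximum the concavity of the square root in the direction x − y,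
tested on vectors reflected into one another (`trA_sub_trA_le`), contradicts the equation. The
required theorem on sums is proved from scratch: sup-convolution makes the functions semiconvex, and
a semiconvex function has second-order expansions near a strict quadratic maximum
(`IsLowerSlope.exists_taylor`), by sliding planes, Rademacher's theorem and Lebesgue density.

Only test functions with nonzero gradient occur: the doubling argument has large gradients and the
barrier is used away from its centre. There the two conventions for κ coincide, hence the class
`JetSuper`. -/

namespace NormalizedPLaplace

open Filter Topology MeasureTheory Metric Set

/-! ### Semiconvex functions: Jensen's lemma and second-order expansions. -/

section Slopes

variable {F : Type*} [NormedAddCommGroup F] [InnerProductSpace ℝ F]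

/-- `p z` is, for every `z`, the slope of a paraboloid of opening `lam` touching `w` from below
at `z`. -/
def IsLowerSlope (lam : ℝ) (w : F → ℝ) (p : F → F) : Prop :=
  ∀ z y, w z + inner ℝ (p z) (y - z) - lam / 2 * ‖y - z‖ ^ 2 ≤ w y

/-- The points of `closedBall z₀ (R / 8)` at which the plane with slope `p z` lies above `w` on
`closedBall z₀ R`. -/
def contactSet (w : F → ℝ) (p : F → F) (z₀ : F) (R : ℝ) : Set F :=
  {z ∈ closedBall z₀ (R / 8) | ∀ y ∈ closedBall z₀ R, w y ≤ w z + inner ℝ (p z) (y - z)}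

/-- Telescoping over N + 1 equal steps leaves a total quadratic error C/(N + 1), which vanishes in
the limit. -/
theorem abs_sub_le_of_forall_abs_sub_le {ψ : ℝ → ℝ} {e C : ℝ}
    (h : ∀ s ∈ Icc (0 : ℝ) 1, ∀ t ∈ Icc (0 : ℝ) 1,
      |ψ s - ψ t| ≤ e * |s - t| + C * (s - t) ^ 2) :
    |ψ 1 - ψ 0| ≤ e := by
  have key : ∀ N : ℕ, |ψ 1 - ψ 0| ≤ e + C * (1 / ((N : ℝ) + 1)) := by
    intro N
    have hN : (0 : ℝ) < (N : ℝ) + 1 := by positivity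
    have h1 : ψ 1 - ψ 0 = ∑ i ∈ Finset.range (N + 1),
        (ψ (((i + 1 : ℕ) : ℝ) / ((N : ℝ) + 1)) - ψ ((i : ℝ) / ((N : ℝ) + 1))) := by
      rw [Finset.sum_range_sub (fun i : ℕ => ψ ((i : ℝ) / ((N : ℝ) + 1)))]
      simp [div_self hN.ne']
    rw [h1]
    refine (Finset.abs_sum_le_sum_abs _ _).trans ?_
    have h2 : ∀ i ∈ Finset.range (N + 1),
        |ψ (((i + 1 : ℕ) : ℝ) / ((N : ℝ) + 1)) - ψ ((i : ℝ) / ((N : ℝ) + 1))| ≤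
          e * (1 / ((N : ℝ) + 1)) + C * (1 / ((N : ℝ) + 1)) ^ 2 := by
      intro i hi
      have hi' : (i : ℝ) + 1 ≤ (N : ℝ) + 1 := by
        exact_mod_cast Finset.mem_range.1 hi
      have hd : ((i + 1 : ℕ) : ℝ) / ((N : ℝ) + 1) - (i : ℝ) / ((N : ℝ) + 1) =
          1 / ((N : ℝ) + 1) := by
        push_cast; ring
      have := h (((i + 1 : ℕ) : ℝ) / ((N : ℝ) + 1))
        ⟨by positivity, by rw [div_le_one hN]; push_cast; exact hi'⟩
        ((i : ℝ) / ((N : ℝ) + 1)) ⟨by positivity, by rw [div_le_one hN]; linarith⟩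
      rwa [hd, abs_of_pos (by positivity : (0 : ℝ) < 1 / ((N : ℝ) + 1))] at this
    refine (Finset.sum_le_sum h2).trans (le_of_eq ?_)
    simp only [Finset.sum_const, Finset.card_range, nsmul_eq_mul]
    push_cast
    field_simp
  have hlim : Tendsto (fun N : ℕ => e + C * (1 / ((N : ℝ) + 1))) atTop (𝓝 (e + C * 0)) :=
    (tendsto_one_div_add_atTop_nhds_zero_nat.const_mul C).const_add e
  have := ge_of_tendsto' hlim key
  simpa using this

/-- Second-order expansion at a point of differentiability of the slope. -/
theorem IsLowerSlope.taylor {lam : ℝ} {w : F → ℝ} {p : F → F} (hp : IsLowerSlope lam w p)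
    {z : F} {M : F →L[ℝ] F} (hM : HasFDerivAt p M z) {ε : ℝ} (hε : 0 < ε) :
    ∀ᶠ h in 𝓝 (0 : F),
      |w (z + h) - w z - inner ℝ (p z) h - 1 / 2 * inner ℝ (M h) h| ≤ ε * ‖h‖ ^ 2 := by
  have h1 : ∀ᶠ h in 𝓝 (0 : F), ‖p (z + h) - p z - M h‖ ≤ ε * ‖h‖ := by
    have := (hasFDerivAt_iff_isLittleO_nhds_zero.1 hM).def hε
    simpa using this
  obtain ⟨r, hr, hball⟩ := Metric.eventually_nhds_iff_ball.1 h1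
  filter_upwards [Metric.ball_mem_nhds (0 : F) hr] with h hh
  have hh' : ‖h‖ < r := by simpa using hh
  -- The remainder along the segment; its increment from 0 to 1 is the quantity to bound. The
  -- paraboloid touching at z + t h bounds increments on one side, and exchanging s and t gives the
  -- other.
  set ψ : ℝ → ℝ := fun t => w (z + t • h) - t * inner ℝ (p z) h - t ^ 2 / 2 * inner ℝ (M h) h
    with hψ
  set C : ℝ := (|lam| + ‖M‖) / 2 * ‖h‖ ^ 2 with hC
  have hone : ∀ s ∈ Icc (0 : ℝ) 1, ∀ t ∈ Icc (0 : ℝ) 1,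
      ψ s - ψ t ≥ -(ε * ‖h‖ ^ 2 * |s - t| + C * (s - t) ^ 2) := by
    intro s hs t ht
    have e1 := hp (z + t • h) (z + s • h)
    have e2 : z + s • h - (z + t • h) = (s - t) • h := by rw [sub_smul]; abel
    rw [e2, inner_smul_right, norm_smul, mul_pow, Real.norm_eq_abs, sq_abs] at e1
    have e3 := hball (t • h) (by
      simp only [mem_ball, dist_zero_right, norm_smul, Real.norm_eq_abs, abs_of_nonneg ht.1]
      nlinarith [ht.2, norm_nonneg h])
    have e4 : |inner ℝ (p (z + t • h) - p z - M (t • h)) h| ≤ ε * ‖h‖ ^ 2 := by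
      refine (abs_real_inner_le_norm _ _).trans ?_
      have : ‖t • h‖ ≤ ‖h‖ := by
        rw [norm_smul, Real.norm_eq_abs, abs_of_nonneg ht.1]
        nlinarith [ht.2, norm_nonneg h]
      nlinarith [norm_nonneg h, mul_le_mul_of_nonneg_left this hε.le]
    rw [inner_sub_left, inner_sub_left, map_smul, real_inner_smul_left] at e4
    have e5 : |inner ℝ (M h) h| ≤ ‖M‖ * ‖h‖ ^ 2 := by
      refine (abs_real_inner_le_norm _ _).trans ?_
      nlinarith [norm_nonneg h, M.le_opNorm h]
    set A := inner ℝ (p (z + t • h)) h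
    set P := inner ℝ (p z) h
    set Q := inner ℝ (M h) h
    have e6 : |(A - P - t * Q) * (s - t)| ≤ ε * ‖h‖ ^ 2 * |s - t| := by
      rw [abs_mul]; exact mul_le_mul_of_nonneg_right e4 (abs_nonneg _)
    have e7 := neg_abs_le ((A - P - t * Q) * (s - t))
    have e8 : lam * ‖h‖ ^ 2 + Q ≤ 2 * C := by
      have := le_abs_self Q
      have := mul_le_mul_of_nonneg_right (le_abs_self lam) (sq_nonneg ‖h‖)
      rw [hC]; linarith
    have e9 := mul_le_mul_of_nonneg_right e8 (sq_nonneg (s - t))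
    simp only [hψ]
    nlinarith
  have := abs_sub_le_of_forall_abs_sub_le (ψ := ψ) (e := ε * ‖h‖ ^ 2) (C := C) (by
    intro s hs t ht
    have a1 := hone s hs t ht
    have a2 := hone t ht s hs
    rw [abs_sub_comm t s] at a2
    rw [abs_le]
    constructor
    · linarith
    · have : (t - s) ^ 2 = (s - t) ^ 2 := by ring
      rw [this] at a2
      linarith)
  simp only [hψ] at this
  convert this using 2
  simp
  ring

/-- Along z + s(p z − q) the paraboloid below and the plane above give s‖p z − q‖² ≤ (lam/2) s²‖p z
− q‖², which is impossible for small s > 0 unless p z = q. -/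
theorem IsLowerSlope.eq_of_contact {lam : ℝ} {w : F → ℝ} {p : F → F} (hp : IsLowerSlope lam w p)
    {z q : F} (h : ∀ᶠ y in 𝓝 z, w y ≤ w z + inner ℝ q (y - z)) : p z = q := by
  by_contra hne
  have hpos : 0 < ‖p z - q‖ ^ 2 := by
    have := norm_pos_iff.2 (sub_ne_zero.2 hne); positivity
  have hlim : Tendsto (fun s : ℝ => z + s • (p z - q)) (𝓝[>] 0) (𝓝 z) := by
    have : Continuous fun s : ℝ => z + s • (p z - q) := by fun_prop
    have h0 := this.tendsto 0
    simp only [zero_smul, add_zero] at h0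
    exact h0.mono_left nhdsWithin_le_nhds
  have hsm : ∀ᶠ s : ℝ in 𝓝[>] 0, lam / 2 * s < 1 := by
    have : Continuous fun s : ℝ => lam / 2 * s := by fun_prop
    have h0 := this.tendsto 0
    simp only [mul_zero] at h0
    exact (h0.mono_left nhdsWithin_le_nhds).eventually (gt_mem_nhds one_pos)
  obtain ⟨s, ⟨hs1, hs2⟩, hs⟩ :=
    ((hlim.eventually h).and hsm).and (self_mem_nhdsWithin) |>.exists
  have hs0 : 0 < s := hs
  have e := hp z (z + s • (p z - q))
  have e2 := e.trans hs1
  simp only [add_sub_cancel_left, inner_smul_right, norm_smul, mul_pow, Real.norm_eq_abs,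
    sq_abs] at e2
  have e3 : inner ℝ (p z) (p z - q) - inner ℝ q (p z - q) = ‖p z - q‖ ^ 2 := by
    rw [← inner_sub_left, real_inner_self_eq_norm_sq]
  have : s * ‖p z - q‖ ^ 2 ≤ (lam / 2 * s) * (s * ‖p z - q‖ ^ 2) := by
    have e4 := congrArg (s * ·) e3
    simp only [mul_sub] at e4
    nlinarith
  nlinarith [mul_pos hs0 hpos]

/-- Three inequalities are compared at a point at distance ‖y − z‖ from y in the direction p y − p
z: the paraboloid at y, the plane above at z, and the paraboloid at z evaluated at y. Only z has to
be a contact point, which later allows differentiability to be extended off the contact set. -/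
theorem IsLowerSlope.norm_sub_le {lam : ℝ} {w : F → ℝ} {p : F → F} (hp : IsLowerSlope lam w p)
    {z₀ : F} {R : ℝ} {y z : F} (hz : z ∈ contactSet w p z₀ R) (hy : y ∈ closedBall z₀ (R / 2))
    (hyz : ‖y - z‖ ≤ R / 2) : ‖p y - p z‖ ≤ |lam| * ‖y - z‖ := by
  have hy1 : dist y z₀ ≤ R / 2 := hy
  rcases eq_or_ne (p y) (p z) with he | hne
  · rw [he, sub_self, norm_zero]; positivity
  rcases eq_or_ne y z with rfl | hyz0
  · exact absurd rfl hne
  have hn : 0 < ‖p y - p z‖ := norm_pos_iff.2 (sub_ne_zero.2 hne)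
  set t := ‖y - z‖ with ht
  have ht0 : 0 < t := norm_pos_iff.2 (sub_ne_zero.2 hyz0)
  set x := y + (t * ‖p y - p z‖⁻¹) • (p y - p z) with hx
  have hxy : ‖x - y‖ = t := by
    rw [hx, add_sub_cancel_left, norm_smul, Real.norm_eq_abs, abs_of_pos (by positivity)]
    field_simp
  have hxR : x ∈ closedBall z₀ R := by
    have : dist x y = t := by rw [dist_eq_norm, hxy]
    have := dist_triangle x y z₀
    rw [mem_closedBall]; linarith
  have a1 := hp y x
  have a2 := hz.2 x hxR
  have a3 := hp z y
  rw [hxy] at a1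
  have a4 : inner ℝ (p y) (x - y) - inner ℝ (p z) (x - y) = t * ‖p y - p z‖ := by
    rw [← inner_sub_left, hx, add_sub_cancel_left, inner_smul_right,
      real_inner_self_eq_norm_sq]
    field_simp
  have a5 : inner ℝ (p z) (x - z) = inner ℝ (p z) (x - y) + inner ℝ (p z) (y - z) := by
    rw [← inner_add_right]; congr 1; abel
  have a6 : t * ‖p y - p z‖ ≤ t * (|lam| * t) := by
    have := mul_le_mul_of_nonneg_right (le_abs_self lam) (sq_nonneg t)
    rw [← ht] at a3
    nlinarith
  exact le_of_mul_le_mul_left a6 ht0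

/-- A map that is differentiable within `K` at `z` is differentiable at `z` if `K` is
asymptotically dense at `z` and the map is controlled by its values on `K`. -/
theorem hasFDerivAt_of_hasFDerivWithinAt {p : F → F} {K : Set F} {z : F} {M : F →L[ℝ] F} {c r : ℝ}
    (hM : HasFDerivWithinAt p M K z) (hr : 0 < r)
    (hc : ∀ y ∈ ball z r, ∀ x ∈ K, ‖p y - p x‖ ≤ c * ‖y - x‖)
    (hd : ∀ ε > 0, ∀ᶠ h in 𝓝[≠] (0 : F), (K ∩ closedBall (z + h) (ε * ‖h‖)).Nonempty) :
    HasFDerivAt p M z := by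
  rw [hasFDerivAt_iff_isLittleO_nhds_zero, Asymptotics.isLittleO_iff]
  intro ε hε
  -- Error budget for replacing z + h by a point x of K within η‖h‖: |c| from moving p, 2 from the
  -- expansion within K (as ‖x − z‖ ≤ 2‖h‖), ‖M‖ from moving the linear part.
  set D : ℝ := |c| + 2 + ‖M‖ with hD
  have hD0 : 0 < D := by positivity
  set η : ℝ := min 1 (ε / D) with hη
  have hη0 : 0 < η := by positivity
  have hη1 : η ≤ 1 := min_le_left _ _
  have hηD : η * D ≤ ε := by
    have : η ≤ ε / D := min_le_right _ _
    rwa [le_div_iff₀ hD0] at this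
  have hw := (hasFDerivWithinAt_iff_isLittleO.1 hM).def hη0
  rw [eventually_nhdsWithin_iff, Metric.eventually_nhds_iff_ball] at hw
  obtain ⟨r', hr', hball⟩ := hw
  have hd' := eventually_nhdsWithin_iff.1 (hd η hη0)
  filter_upwards [hd', Metric.ball_mem_nhds (0 : F) (half_pos hr'),
    Metric.ball_mem_nhds (0 : F) hr] with h h1 h2 h3
  rcases eq_or_ne h 0 with rfl | hh
  · simp
  obtain ⟨x, hxK, hx⟩ := h1 hh
  have hh2 : ‖h‖ < r' / 2 := by simpa using h2
  have hh3 : ‖h‖ < r := by simpa using h3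
  have hx1 : ‖z + h - x‖ ≤ η * ‖h‖ := by
    rw [← dist_eq_norm, dist_comm]; exact hx
  have hx2 : ‖x - z‖ ≤ 2 * ‖h‖ := by
    have : x - z = h - (z + h - x) := by abel
    rw [this]
    refine (norm_sub_le _ _).trans ?_
    nlinarith [norm_nonneg h]
  have b1 : ‖p (z + h) - p x‖ ≤ |c| * (η * ‖h‖) :=
    (hc _ (by simpa using hh3) x hxK).trans
      ((mul_le_mul_of_nonneg_right (le_abs_self c) (norm_nonneg _)).trans
        (mul_le_mul_of_nonneg_left hx1 (abs_nonneg c)))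
  have b2 : ‖p x - p z - M (x - z)‖ ≤ η * (2 * ‖h‖) :=
    (hball x (by rw [mem_ball, dist_eq_norm]; linarith) hxK).trans
      (mul_le_mul_of_nonneg_left hx2 hη0.le)
  have b3 : ‖M (x - (z + h))‖ ≤ ‖M‖ * (η * ‖h‖) := by
    refine (M.le_opNorm _).trans (mul_le_mul_of_nonneg_left ?_ (norm_nonneg _))
    rwa [norm_sub_rev]
  have e : p (z + h) - p z - M h =
      (p (z + h) - p x) + (p x - p z - M (x - z)) + M (x - (z + h)) := by
    have : M (x - z) = M h + M (x - (z + h)) := by rw [← map_add]; congr 1; abel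
    rw [this]; abel
  rw [e]
  refine (norm_add₃_le).trans ?_
  have : |c| * (η * ‖h‖) + η * (2 * ‖h‖) + ‖M‖ * (η * ‖h‖) = (η * D) * ‖h‖ := by rw [hD]; ring
  have h4 := mul_le_mul_of_nonneg_right hηD (norm_nonneg h)
  linarith

/-- At a Lebesgue density point, K fills almost all of the small balls about z + h of radius
proportional to ‖h‖, so it meets them. -/
theorem ae_density_nonempty [FiniteDimensional ℝ F] [MeasurableSpace F] [BorelSpace F]
    (μ : Measure F) [μ.IsAddHaarMeasure] (K : Set F) :
    ∀ᵐ z ∂μ.restrict K, ∀ ε > 0,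
      ∀ᶠ h in 𝓝[≠] (0 : F), (K ∩ closedBall (z + h) (ε * ‖h‖)).Nonempty := by
  have h := ae_all_iff.2 fun N : ℕ =>
    IsUnifLocDoublingMeasure.ae_tendsto_measure_inter_div μ K ((N : ℝ) + 1)
  filter_upwards [h] with z hz ε hε
  obtain ⟨N, hN⟩ := exists_nat_one_div_lt hε
  have hN0 : (0 : ℝ) < (N : ℝ) + 1 := by positivity
  have hn : Tendsto (fun h : F => 1 / ((N : ℝ) + 1) * ‖h‖) (𝓝[≠] 0) (𝓝[>] 0) := by
    refine tendsto_nhdsWithin_iff.2 ⟨?_, ?_⟩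
    · have : Continuous fun h : F => 1 / ((N : ℝ) + 1) * ‖h‖ := by fun_prop
      have h0 := this.tendsto 0
      simp only [norm_zero, mul_zero] at h0
      exact h0.mono_left nhdsWithin_le_nhds
    · filter_upwards [self_mem_nhdsWithin] with h hh
      have : 0 < ‖h‖ := norm_pos_iff.2 hh
      exact mem_Ioi.2 (by positivity)
  have ht := hz N (fun h : F => z + h) (fun h : F => 1 / ((N : ℝ) + 1) * ‖h‖) hn
    (Eventually.of_forall fun h => by
      rw [mem_closedBall, dist_eq_norm]
      have : ((N : ℝ) + 1) * (1 / ((N : ℝ) + 1) * ‖h‖) = ‖h‖ := by field_simp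
      rw [this]; simp)
  filter_upwards [ht.eventually (lt_mem_nhds (zero_lt_one))] with h hh
  have hne : (K ∩ closedBall (z + h) (1 / ((N : ℝ) + 1) * ‖h‖)).Nonempty := by
    by_contra hemp
    rw [not_nonempty_iff_eq_empty] at hemp
    rw [hemp, measure_empty, ENNReal.zero_div] at hh
    exact lt_irrefl _ hh
  refine hne.mono (inter_subset_inter_right _ (closedBall_subset_closedBall ?_))
  exact mul_le_mul_of_nonneg_right hN.le (norm_nonneg h)

/-- Near a strict quadratic maximum of a semiconvex function there are points at which the
function has a second-order expansion, with small slope and nonpositive Hessian. -/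
theorem IsLowerSlope.exists_taylor [FiniteDimensional ℝ F] {lam : ℝ} {w : F → ℝ} {p : F → F}
    (hp : IsLowerSlope lam w p) (hw : Continuous w) {z₀ : F} {R κ : ℝ} (hR : 0 < R) (hκ : 0 < κ)
    (hmax : ∀ z ∈ closedBall z₀ R, w z ≤ w z₀ - κ * ‖z - z₀‖ ^ 2) {ρ : ℝ} (hρ : 0 < ρ) :
    ∃ (z q : F) (M : F →L[ℝ] F), ‖z - z₀‖ ≤ ρ ∧ ‖q‖ ≤ ρ ∧ (∀ h, inner ℝ (M h) h ≤ 0) ∧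
      ∀ ε > 0, ∀ᶠ h in 𝓝 (0 : F),
        |w (z + h) - w z - inner ℝ q h - 1 / 2 * inner ℝ (M h) h| ≤ ε * ‖h‖ ^ 2 := by
  let _ : MeasurableSpace F := borel F
  have : BorelSpace F := ⟨rfl⟩
  -- Full-dimensional Hausdorff measure is a Haar measure and is controlled under Lipschitz maps.
  set μ : Measure F := Measure.hausdorffMeasure (Module.finrank ℝ F) with hμ
  set R' : ℝ := min R (4 * ρ) with hR'
  have hR'0 : 0 < R' := by positivity
  have hR'R : R' ≤ R := min_le_left _ _
  have hR'ρ : R' ≤ 4 * ρ := min_le_right _ _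
  -- For ‖q‖ ≤ κR'/8 the strict maximum forces w − ⟨q, ·⟩ to be maximal within R'/8 of z₀. Hence
  -- every such slope is attained on K, and the Lipschitz map p sends K onto a set of positive
  -- measure.
  set ρ' : ℝ := min ρ (κ * (R' / 8)) with hρ'
  have hρ'0 : 0 < ρ' := by positivity
  set K : Set F := contactSet w p z₀ R' ∩ {z | ‖p z‖ ≤ ρ'} with hK
  have hlip : LipschitzOnWith (Real.toNNReal |lam|) p K := by
    refine LipschitzOnWith.of_dist_le_mul fun x hx y hy => ?_
    rw [Real.coe_toNNReal _ (abs_nonneg _), dist_eq_norm, dist_eq_norm]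
    have hx1 : dist x z₀ ≤ R' / 8 := hx.1.1
    have hy1 : dist y z₀ ≤ R' / 8 := hy.1.1
    refine hp.norm_sub_le hy.1 (by rw [mem_closedBall]; linarith) ?_
    have := dist_triangle_right x y z₀
    rw [← dist_eq_norm]; linarith
  have himage : closedBall (0 : F) ρ' ⊆ p '' K := by
    intro q hq
    have hq1 : ‖q‖ ≤ ρ' := by simpa using hq
    have hq2 : ‖q‖ ≤ κ * (R' / 8) := hq1.trans (min_le_right _ _)
    obtain ⟨z, hz, hzmax⟩ := (isCompact_closedBall z₀ R').exists_isMaxOn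
      ⟨z₀, mem_closedBall_self hR'0.le⟩
      (f := fun z => w z - inner ℝ q z) (by fun_prop)
    have hz0 := hzmax (mem_closedBall_self hR'0.le)
    simp only [mem_ofPred_eq] at hz0
    have hz1 := hmax z (closedBall_subset_closedBall hR'R hz)
    have hz2 : inner ℝ q z₀ - inner ℝ q z ≤ ‖q‖ * ‖z - z₀‖ := by
      rw [← inner_sub_right, norm_sub_rev]; exact real_inner_le_norm _ _
    have hz3 : ‖z - z₀‖ ≤ R' / 8 := by
      by_contra hcon
      push Not at hcon
      have : ‖q‖ * ‖z - z₀‖ < κ * ‖z - z₀‖ ^ 2 := by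
        have : 0 < ‖z - z₀‖ := by linarith
        have : ‖q‖ < κ * ‖z - z₀‖ := hq2.trans_lt (by gcongr)
        nlinarith
      linarith
    have hcon : ∀ y ∈ closedBall z₀ R', w y ≤ w z + inner ℝ q (y - z) := by
      intro y hy
      have := hzmax hy
      simp only [mem_ofPred_eq] at this
      rw [inner_sub_right]; linarith
    have hpq : p z = q := hp.eq_of_contact (by
      have hzb : closedBall z₀ R' ∈ 𝓝 z := by
        refine mem_of_superset (Metric.ball_mem_nhds z (half_pos hR'0)) fun y hy => ?_
        have h1 : dist y z < R' / 2 := hy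
        have h2 := dist_triangle y z z₀
        rw [← dist_eq_norm] at hz3
        rw [mem_closedBall]; linarith
      filter_upwards [hzb] with y hy using hcon y hy)
    refine ⟨z, ⟨⟨?_, ?_⟩, ?_⟩, hpq⟩
    · rw [mem_closedBall, dist_eq_norm]; linarith
    · rwa [hpq]
    · rwa [mem_ofPred_eq, hpq]
  have hμK : μ K ≠ 0 := by
    intro h0
    have h1 := hlip.hausdorffMeasure_image_le (d := Module.finrank ℝ F) (by positivity)
    rw [← hμ, h0, mul_zero] at h1
    have h2 : μ (closedBall (0 : F) ρ') ≤ 0 := (measure_mono himage).trans h1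
    have h3 : 0 < μ (closedBall (0 : F) ρ') := Metric.measure_closedBall_pos μ 0 hρ'0
    exact absurd h2 (not_le.2 h3)
  have hae : ∀ᵐ z ∂μ.restrict K, (z ∈ K → DifferentiableWithinAt ℝ p K z) ∧
      ∀ ε > 0, ∀ᶠ h in 𝓝[≠] (0 : F), (K ∩ closedBall (z + h) (ε * ‖h‖)).Nonempty :=
    (ae_restrict_of_ae hlip.ae_differentiableWithinAt_of_mem).and (ae_density_nonempty μ K)
  obtain ⟨z, hzK, hzd, hzn⟩ : ∃ z ∈ K, (z ∈ K → DifferentiableWithinAt ℝ p K z) ∧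
      ∀ ε > 0, ∀ᶠ h in 𝓝[≠] (0 : F), (K ∩ closedBall (z + h) (ε * ‖h‖)).Nonempty := by
    by_contra hcon
    push Not at hcon
    apply hμK
    rw [← Measure.restrict_apply_self μ K]
    refine measure_mono_null (fun z hz => ?_) (ae_iff.1 hae)
    intro hz'
    obtain ⟨ε, hε, hh⟩ := hcon z hz hz'.1
    have hh2 := hz'.2 ε hε
    apply hh
    filter_upwards [hh2] with a ha using ha.ne_empty
  have hz0 : dist z z₀ ≤ R' / 8 := hzK.1.1
  -- Rademacher's theorem differentiates p only within K; density of K at z makes this a full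
  -- derivative.
  have hder : HasFDerivAt p (fderivWithin ℝ p K z) z := by
    refine hasFDerivAt_of_hasFDerivWithinAt (c := |lam|) (r := R' / 8)
      (hzd hzK).hasFDerivWithinAt (by positivity) (fun y hy x hx => ?_) hzn
    have hx1 : dist x z₀ ≤ R' / 8 := hx.1.1
    have hy1 : dist y z < R' / 8 := hy
    have h1 := dist_triangle y z z₀
    have h2 := dist_triangle_right y x z₀
    exact hp.norm_sub_le hx.1 (by rw [mem_closedBall]; linarith)
      (by rw [← dist_eq_norm]; linarith)
  set M := fderivWithin ℝ p K z
  refine ⟨z, p z, M, ?_, hzK.2.trans (min_le_left _ _), ?_, fun ε hε => hp.taylor hder hε⟩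
  · rw [← dist_eq_norm]; linarith
  · intro h
    by_contra hcon
    push Not at hcon
    have hh : h ≠ 0 := by rintro rfl; simp at hcon
    have hn : 0 < ‖h‖ := norm_pos_iff.2 hh
    set m := inner ℝ (M h) h with hm
    have h1 := hp.taylor hder (ε := m / (4 * ‖h‖ ^ 2)) (by positivity)
    have h2 : Tendsto (fun t : ℝ => t • h) (𝓝[>] 0) (𝓝 0) := by
      have : Continuous fun t : ℝ => t • h := by fun_prop
      have h0 := this.tendsto 0
      simp only [zero_smul] at h0
      exact h0.mono_left nhdsWithin_le_nhds
    have h3 : ∀ᶠ y in 𝓝 (0 : F), w (z + y) ≤ w z + inner ℝ (p z) y := by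
      filter_upwards [Metric.ball_mem_nhds (0 : F) (half_pos hR'0)] with y hy
      have hy' : ‖y‖ < R' / 2 := by simpa using hy
      have := hzK.1.2 (z + y) (by
        have := dist_triangle (z + y) z z₀
        rw [dist_self_add_left] at this
        rw [mem_closedBall]; linarith)
      simpa using this
    obtain ⟨t, ⟨ht1, ht2⟩, ht⟩ := ((h2.eventually h1).and (h2.eventually h3)).and
      self_mem_nhdsWithin |>.exists
    have ht0 : 0 < t := ht
    have h4 := (abs_le.1 ht1).1
    rw [map_smul, real_inner_smul_left, inner_smul_right (M h), ← hm, norm_smul, mul_pow,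
      Real.norm_eq_abs, sq_abs] at h4
    have h5 : m / (4 * ‖h‖ ^ 2) * (t ^ 2 * ‖h‖ ^ 2) = m * t ^ 2 / 4 := by field_simp
    rw [h5] at h4
    nlinarith [mul_pos hcon (pow_pos ht0 2)]

end Slopes

/-! ### The theorem on sums. -/

section Sums

variable {F : Type*} [NormedAddCommGroup F] [InnerProductSpace ℝ F]

/-- Second-order expansion of `f` at `x`, with gradient `a` and Hessian `X`. -/
def HasTaylor (f : F → ℝ) (x a : F) (X : F →L[ℝ] F →L[ℝ] ℝ) : Prop :=
  ∀ ε > 0, ∀ᶠ h in 𝓝 (0 : F),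
    |f (x + h) - f x - inner ℝ a h - 1 / 2 * X h h| ≤ ε * ‖h‖ ^ 2

/-- The inner product as a bilinear map. -/
noncomputable def innerBilin (F : Type*) [NormedAddCommGroup F] [InnerProductSpace ℝ F] :
    F →L[ℝ] F →L[ℝ] ℝ :=
  (isBoundedBilinearMap_inner (𝕜 := ℝ) (E := F)).toContinuousLinearMap

@[simp]
theorem innerBilin_apply (h k : F) : innerBilin F h k = inner ℝ h k := rfl

theorem tendsto_smul_nhdsGT_zero (h : F) : Tendsto (fun t : ℝ => t • h) (𝓝[>] 0) (𝓝 0) := by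
  have : Continuous fun t : ℝ => t • h := by fun_prop
  have h0 := this.tendsto 0
  simp only [zero_smul] at h0
  exact h0.mono_left nhdsWithin_le_nhds

/-- Second-order expansions near a point where a semiconvex function is touched from above by a
quadratic function. -/
theorem IsLowerSlope.exists_hasTaylor [FiniteDimensional ℝ F] {lam : ℝ} {G : F → ℝ} {p : F → F}
    (hp : IsLowerSlope lam G p) (hG : Continuous G) {z₀ g : F} {A : F →L[ℝ] F →L[ℝ] ℝ}
    (hA : ∀ h k, A h k = A k h)
    (hmax : ∀ᶠ z in 𝓝 z₀, G z ≤ G z₀ + inner ℝ g (z - z₀) + 1 / 2 * A (z - z₀) (z - z₀))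
    {ρ : ℝ} (hρ : 0 < ρ) :
    ∃ (z ζ : F) (Q : F →L[ℝ] F →L[ℝ] ℝ), ‖z - z₀‖ ≤ ρ ∧ ‖ζ - g‖ ≤ ρ ∧
      (∀ h, Q h h ≤ A h h + ρ * ‖h‖ ^ 2) ∧ HasTaylor G z ζ Q := by
  obtain ⟨R, hR, hball⟩ := Metric.eventually_nhds_iff_ball.1 hmax
  -- Subtracting κ‖z − z₀‖² as well makes the maximum strict; undoing this costs 2κ = ρ in the
  -- Hessian.
  set κ : ℝ := ρ / 2 with hκ
  have hκ0 : 0 < κ := by positivity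
  set J := (InnerProductSpace.toDual ℝ F).symm with hJ
  have hJi : ∀ v k, inner ℝ (J (A v)) k = A v k := fun v k => by
    rw [hJ, InnerProductSpace.toDual_symm_apply]
  set w : F → ℝ := fun z =>
    G z - inner ℝ g (z - z₀) - 1 / 2 * A (z - z₀) (z - z₀) - κ * ‖z - z₀‖ ^ 2 with hw
  set p' : F → F := fun z => p z - g - J (A (z - z₀)) - (2 * κ) • (z - z₀) with hp'
  have hA2 : ∀ v h : F, A (v + h) (v + h) = A v v + 2 * A v h + A h h := fun v h => by
    simp only [map_add, add_apply]; rw [hA h v]; ring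
  have hN2 : ∀ v h : F, ‖v + h‖ ^ 2 = ‖v‖ ^ 2 + 2 * inner ℝ v h + ‖h‖ ^ 2 := norm_add_sq_real
  have hAb : ∀ h : F, |A h h| ≤ ‖A‖ * ‖h‖ ^ 2 := fun h => by
    have := A.le_opNorm₂ h h
    rw [Real.norm_eq_abs] at this
    linarith
  have hslope : IsLowerSlope (lam + ‖A‖ + 2 * κ) w p' := by
    intro z y
    have h1 := hp z y
    obtain ⟨v, hv⟩ : ∃ v, z - z₀ = v := ⟨_, rfl⟩
    obtain ⟨h, hh⟩ : ∃ h, y - z = h := ⟨_, rfl⟩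
    have e : y - z₀ = v + h := by rw [← hv, ← hh]; abel
    rw [hh] at h1
    simp only [hw, hp', e, hv, hh]
    simp only [ hA2, hN2, inner_sub_left, hJi, real_inner_smul_left,
      inner_add_right]
    have := (abs_le.1 (hAb h)).2
    nlinarith
  have hwc : Continuous w := by
    have : Continuous fun z : F => A (z - z₀) (z - z₀) := by fun_prop
    fun_prop
  have hw0 : w z₀ = G z₀ := by simp [hw]
  obtain ⟨z, q, M, hz, hq, hM, hT⟩ := hslope.exists_taylor hwc (R := R / 2) (κ := κ) (z₀ := z₀)
    (by positivity) hκ0 (fun z hz => by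
      have := hball z (closedBall_subset_ball (by linarith) hz)
      rw [hw0]; simp only [hw]; linarith) (ρ := min (ρ / 2) (ρ / (2 * (‖A‖ + ρ)))) (by positivity)
  have hA0 := norm_nonneg A
  have hz1 : ‖z - z₀‖ ≤ ρ / 2 := hz.trans (min_le_left _ _)
  have hz2 : (‖A‖ + ρ) * ‖z - z₀‖ ≤ ρ / 2 := by
    have := hz.trans (min_le_right _ _)
    rw [le_div_iff₀ (by positivity)] at this
    linarith
  have hq1 : ‖q‖ ≤ ρ / 2 := hq.trans (min_le_left _ _)
  refine ⟨z, q + g + J (A (z - z₀)) + (2 * κ) • (z - z₀),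
    (innerBilin F).comp M + A + (2 * κ) • innerBilin F, by linarith, ?_, ?_, ?_⟩
  · have e : q + g + J (A (z - z₀)) + (2 * κ) • (z - z₀) - g =
        q + J (A (z - z₀)) + (2 * κ) • (z - z₀) := by abel
    rw [e]
    refine norm_add₃_le.trans ?_
    have h1 : ‖J (A (z - z₀))‖ ≤ ‖A‖ * ‖z - z₀‖ := by
      rw [hJ, LinearIsometryEquiv.norm_map]; exact A.le_opNorm _
    have h2 : ‖(2 * κ) • (z - z₀)‖ = ρ * ‖z - z₀‖ := by
      rw [norm_smul, Real.norm_eq_abs, abs_of_pos (by positivity)]; rw [hκ]; ring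
    linarith
  · intro h
    have := hM h
    simp only [add_apply, ContinuousLinearMap.comp_apply, smul_apply, innerBilin_apply,
      smul_eq_mul, real_inner_self_eq_norm_sq]
    rw [hκ]; linarith
  · intro ε hε
    filter_upwards [hT ε hε] with h hh
    convert hh using 2
    have e : z + h - z₀ = (z - z₀) + h := by abel
    simp only [hw, e, hA2, hN2, inner_add_left, inner_add_right, hJi, real_inner_smul_left,
      add_apply, ContinuousLinearMap.comp_apply, smul_apply, innerBilin_apply,
      smul_eq_mul, real_inner_self_eq_norm_sq]
    ring

theorem HasTaylor.comp_add {E : Type*} [NormedAddCommGroup E] [InnerProductSpace ℝ E]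
    {G : F → ℝ} {z ζ : F} {Q : F →L[ℝ] F →L[ℝ] ℝ} (hT : HasTaylor G z ζ Q) (i : E →L[ℝ] F)
    {f : E → ℝ} {x a : E} (hf : ∀ h, f (x + h) - f x = G (z + i h) - G z)
    (ha : ∀ h, inner ℝ a h = inner ℝ ζ (i h)) :
    HasTaylor f x a (Q.bilinearComp i i) := by
  intro ε hε
  have hi : Tendsto i (𝓝 0) (𝓝 0) := by simpa using i.continuous.tendsto 0
  filter_upwards [hi.eventually (hT (ε / (‖i‖ ^ 2 + 1)) (by positivity))] with h hh
  rw [hf h, ha h]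
  refine hh.trans ?_
  have h1 : ‖i h‖ ^ 2 ≤ ‖i‖ ^ 2 * ‖h‖ ^ 2 := by
    rw [← mul_pow]; exact pow_le_pow_left₀ (norm_nonneg _) (i.le_opNorm h) 2
  rw [div_mul_eq_mul_div, div_le_iff₀ (by positivity)]
  nlinarith [sq_nonneg ‖h‖, mul_le_mul_of_nonneg_left h1 hε.le,
    mul_nonneg hε.le (sq_nonneg ‖h‖)]

theorem HasTaylor.neg {f : F → ℝ} {x a : F} {X : F →L[ℝ] F →L[ℝ] ℝ} (h : HasTaylor f x a X) :
    HasTaylor (fun y => -f y) x (-a) (-X) := by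
  intro ε hε
  filter_upwards [h ε hε] with k hk
  rw [← abs_neg]
  convert hk using 2
  simp only [inner_neg_left, neg_apply]
  ring

theorem HasTaylor.eventually_line {f : F → ℝ} {x a : F} {X : F →L[ℝ] F →L[ℝ] ℝ}
    (h : HasTaylor f x a X) (v : F) {ε : ℝ} (hε : 0 < ε) :
    ∀ᶠ t : ℝ in 𝓝[>] 0,
      |f (x + t • v) - f x - t * inner ℝ a v - 1 / 2 * (t ^ 2 * X v v)| ≤ ε * t ^ 2 := by
  filter_upwards [(tendsto_smul_nhdsGT_zero v).eventually
    (h (ε / (‖v‖ ^ 2 + 1)) (by positivity))] with t ht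
  simp only [inner_smul_right, map_smul, smul_apply, smul_eq_mul, norm_smul, mul_pow,
    Real.norm_eq_abs, sq_abs] at ht
  rw [show t * (t * X v v) = t ^ 2 * X v v by ring] at ht
  refine ht.trans ?_
  rw [div_mul_eq_mul_div, div_le_iff₀ (by positivity)]
  nlinarith [mul_nonneg hε.le (sq_nonneg t)]

/-- The theorem on sums for a semiconvex and a semiconcave function. -/
theorem exists_hasTaylor_sub {E : Type*} [NormedAddCommGroup E] [InnerProductSpace ℝ E]
    [FiniteDimensional ℝ E] {lam : ℝ} {f g : E → ℝ} {p q : E → E}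
    (hf : IsLowerSlope lam f p) (hg : IsLowerSlope lam (fun y => -g y) q)
    (hfc : Continuous f) (hgc : Continuous g) {x₀ y₀ a b : E} {Z : E →L[ℝ] E →L[ℝ] ℝ}
    (hZ : ∀ h k, Z h k = Z k h) {m : ℝ}
    (hmax : ∀ᶠ z in 𝓝 (x₀, y₀), f z.1 - g z.2 ≤ f x₀ - g y₀ + inner ℝ a (z.1 - x₀)
      - inner ℝ b (z.2 - y₀) + 1 / 2 * (Z (z.1 - x₀ - (z.2 - y₀)) (z.1 - x₀ - (z.2 - y₀))
        + m * ‖z.1 - x₀‖ ^ 2)) {ρ : ℝ} (hρ : 0 < ρ) :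
    ∃ (x y a' b' : E) (X Y : E →L[ℝ] E →L[ℝ] ℝ), ‖x - x₀‖ ≤ ρ ∧ ‖y - y₀‖ ≤ ρ ∧
      ‖a' - a‖ ≤ ρ ∧ ‖b' - b‖ ≤ ρ ∧ HasTaylor f x a' X ∧ HasTaylor g y b' Y ∧
      ∀ h k, X h h - Y k k ≤ Z (h - k) (h - k) + m * ‖h‖ ^ 2 + ρ * (‖h‖ ^ 2 + ‖k‖ ^ 2) := by
  let e := WithLp.prodContinuousLinearEquiv 2 ℝ E E
  let P₁ : WithLp 2 (E × E) →L[ℝ] E := (ContinuousLinearMap.fst ℝ E E).comp (e : WithLp 2 (E × E) →L[ℝ] E × E)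
  let P₂ : WithLp 2 (E × E) →L[ℝ] E := (ContinuousLinearMap.snd ℝ E E).comp (e : WithLp 2 (E × E) →L[ℝ] E × E)
  let i₁ : E →L[ℝ] WithLp 2 (E × E) := (e.symm : (E × E) →L[ℝ] _).comp (.inl ℝ E E)
  let i₂ : E →L[ℝ] WithLp 2 (E × E) := (e.symm : (E × E) →L[ℝ] _).comp (.inr ℝ E E)
  have hi₁ : ∀ h, i₁ h = WithLp.toLp 2 (h, 0) := fun z => rfl
  have hi₂ : ∀ h, i₂ h = WithLp.toLp 2 (0, h) := fun z => rfl
  have hinner : ∀ v w : WithLp 2 (E × E),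
      inner ℝ v w = inner ℝ v.fst w.fst + inner ℝ v.snd w.snd := fun _ _ => rfl
  set G : WithLp 2 (E × E) → ℝ := fun z => f z.fst - g z.snd with hG
  have hGc : Continuous G := (hfc.comp P₁.continuous).sub (hgc.comp P₂.continuous)
  set A : WithLp 2 (E × E) →L[ℝ] WithLp 2 (E × E) →L[ℝ] ℝ :=
    Z.bilinearComp (P₁ - P₂) (P₁ - P₂) + m • (innerBilin E).bilinearComp P₁ P₁
    with hA
  have hAa : ∀ h k, A h k = Z (h.fst - h.snd) (k.fst - k.snd) + m * inner ℝ h.fst k.fst :=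
    fun h k => rfl
  have hslope : IsLowerSlope lam G (fun z => WithLp.toLp 2 (p z.fst, q z.snd)) := by
    intro z y
    have h1 := hf z.fst y.fst
    have h2 : -g z.snd + _ - _ ≤ -g y.snd := hg z.snd y.snd
    simp only [hG, hinner, WithLp.prod_norm_sq_eq_of_L2, WithLp.sub_fst, WithLp.sub_snd,
      WithLp.toLp_fst, WithLp.toLp_snd]
    linarith only [h1, h2]
  obtain ⟨z, ζ, Q, hz, hζ, hQ, hT⟩ := hslope.exists_hasTaylor hGc
    (z₀ := WithLp.toLp 2 (x₀, y₀)) (g := WithLp.toLp 2 (a, -b)) (A := A)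
    (fun h k => by rw [hAa, hAa, hZ, real_inner_comm]) (by
      have : Tendsto e (𝓝 (WithLp.toLp 2 (x₀, y₀))) (𝓝 (x₀, y₀)) := e.continuous.tendsto _
      filter_upwards [this.eventually hmax] with z hz
      have h1 : (e z).1 = z.fst := rfl
      have h2 : (e z).2 = z.snd := rfl
      rw [h1, h2] at hz
      simp only [hG, hAa, hinner, WithLp.toLp_fst, WithLp.toLp_snd, WithLp.sub_fst, WithLp.sub_snd,
        inner_neg_left, real_inner_self_eq_norm_sq]
      linarith) hρ
  have hfst : ∀ z : WithLp 2 (E × E), ‖z.fst‖ ≤ ‖z‖ := fun z => by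
    refine le_of_sq_le_sq ?_ (norm_nonneg _)
    rw [WithLp.prod_norm_sq_eq_of_L2]; nlinarith [sq_nonneg ‖z.snd‖]
  have hsnd : ∀ z : WithLp 2 (E × E), ‖z.snd‖ ≤ ‖z‖ := fun z => by
    refine le_of_sq_le_sq ?_ (norm_nonneg _)
    rw [WithLp.prod_norm_sq_eq_of_L2]; nlinarith [sq_nonneg ‖z.fst‖]
  have hTf : HasTaylor f z.fst ζ.fst (Q.bilinearComp i₁ i₁) :=
    hT.comp_add i₁ (fun h => by simp [hG, hi₁]) (fun h => by simp [hi₁, WithLp.prod_inner_apply])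
  have hTg : HasTaylor (fun y => -g y) z.snd ζ.snd (Q.bilinearComp i₂ i₂) :=
    hT.comp_add i₂ (fun h => by simp [hG, hi₂]; ring)
      (fun h => by simp [hi₂, WithLp.prod_inner_apply])
  have hTg' : HasTaylor g z.snd (-ζ.snd) (-(Q.bilinearComp i₂ i₂)) := by
    simpa using hTg.neg
  refine ⟨z.fst, z.snd, ζ.fst, -ζ.snd, Q.bilinearComp i₁ i₁, -(Q.bilinearComp i₂ i₂),
    (hfst _).trans hz, (hsnd _).trans hz, (hfst _).trans hζ, ?_, hTf, hTg', ?_⟩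
  · refine le_trans (le_of_eq ?_) ((hsnd _).trans hζ)
    rw [← norm_neg]; congr 1; simp; abel
  · intro h k
    have h1 := hQ (WithLp.toLp 2 (h, k))
    rw [hAa, WithLp.prod_norm_sq_eq_of_L2] at h1
    simp only [real_inner_self_eq_norm_sq] at h1
    refine le_trans (le_of_eq ?_) h1
    set ξ : WithLp 2 (E × E) := WithLp.toLp 2 (h, k) with hξ
    -- The mixed part of Q. It vanishes because G separates the variables: comparing the three
    -- expansions along rays at a common t gives |c| ≤ 6ε.
    set c := Q ξ ξ - Q (i₁ h) (i₁ h) - Q (i₂ k) (i₂ k) with hc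
    have hbound : ∀ ε > 0, |c| ≤ 6 * ε := by
      intro ε hε
      obtain ⟨t, ⟨⟨t1, t2⟩, t3⟩, ht⟩ := (((hT.eventually_line ξ hε).and
        (hTf.eventually_line h hε)).and (hTg.eventually_line k hε)).and
        self_mem_nhdsWithin |>.exists
      have ht0 : 0 < t ^ 2 := pow_pos (mem_Ioi.1 ht) 2
      have e1 : G (z + t • ξ) = f (z.fst + t • h) - g (z.snd + t • k) := rfl
      have e2 : inner ℝ ζ ξ = inner ℝ ζ.fst h + inner ℝ ζ.snd k := rfl
      have e3 : G z = f z.fst - g z.snd := rfl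
      rw [e1, e2, e3] at t1
      rw [ContinuousLinearMap.bilinearComp_apply] at t2 t3
      have e4 : t ^ 2 * c = t ^ 2 * Q ξ ξ - t ^ 2 * Q (i₁ h) (i₁ h) - t ^ 2 * Q (i₂ k) (i₂ k) := by
        rw [hc]; ring
      rw [abs_le] at t1 t2 t3
      refine le_of_mul_le_mul_left ?_ ht0
      rw [← abs_of_pos ht0, ← abs_mul, abs_of_pos ht0, e4, abs_le]
      constructor <;> linarith [t1.1, t1.2, t2.1, t2.2, t3.1, t3.2]
    have hc0 : c = 0 := by
      by_contra hne
      have hpos : 0 < |c| := abs_pos.2 hne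
      linarith [hbound (|c| / 12) (by positivity)]
    simp only [neg_apply, ContinuousLinearMap.bilinearComp_apply]
    linarith

end Sums

/-! ### Sup-convolution. -/

section SupConvolution

variable {F : Type*} [NormedAddCommGroup F]

/-- The sup-convolution of `v` over the set `D`, with paraboloids of opening `N`. -/
noncomputable def supConv (D : Set F) (N : ℝ) (v : F → ℝ) (x : F) : ℝ :=
  sSup ((fun z => v z - N / 2 * ‖x - z‖ ^ 2) '' D)

variable {D : Set F} {N : ℝ} {v : F → ℝ}

theorem exists_supConv_eq (hD : IsCompact D) (hne : D.Nonempty) (hv : ContinuousOn v D) (N : ℝ)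
    (x : F) : ∃ z ∈ D, supConv D N v x = v z - N / 2 * ‖x - z‖ ^ 2 := by
  have hc : ContinuousOn (fun z => v z - N / 2 * ‖x - z‖ ^ 2) D := by fun_prop
  obtain ⟨z, hz, hzs⟩ := hD.exists_sSup_image_eq hne hc
  exact ⟨z, hz, hzs⟩

theorem le_supConv (hD : IsCompact D) (hv : ContinuousOn v D) (N : ℝ) (x : F) {z : F}
    (hz : z ∈ D) : v z - N / 2 * ‖x - z‖ ^ 2 ≤ supConv D N v x := by
  have hc : ContinuousOn (fun z => v z - N / 2 * ‖x - z‖ ^ 2) D := by fun_prop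
  exact le_csSup (hD.bddAbove_image hc) ⟨z, hz, rfl⟩

theorem continuous_supConv (hD : IsCompact D) (hv : ContinuousOn v D) (N : ℝ) :
    Continuous (supConv D N v) := by
  have : CompactSpace D := isCompact_iff_compactSpace.1 hD
  have hv' : Continuous (fun z : D => v z) := continuousOn_iff_continuous_domRestrict.1 hv
  have h := isCompact_univ.continuous_sSup (K := (univ : Set D))
    (f := fun (x : F) (z : D) => v z - N / 2 * ‖x - z‖ ^ 2) (by
      exact (hv'.comp continuous_snd).sub (continuous_const.mul
        ((continuous_fst.sub (continuous_subtype_val.comp continuous_snd)).norm.pow 2)))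
  convert h using 2 with x
  unfold supConv
  congr 1
  ext s; simp

variable [InnerProductSpace ℝ F]

/-- A supremum of paraboloids of opening N: the one that is active at x, with vertex z, touches from
below with slope N(z − x). -/
theorem exists_isLowerSlope_supConv (hD : IsCompact D) (hne : D.Nonempty) (hv : ContinuousOn v D)
    (N : ℝ) : ∃ p, IsLowerSlope N (supConv D N v) p := by
  choose z hz hzs using exists_supConv_eq hD hne hv N
  refine ⟨fun x => N • (z x - x), fun x y => ?_⟩
  have h1 := le_supConv hD hv N y (hz x)
  rw [hzs x]
  have e : y - z x = (x - z x) + (y - x) := by abel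
  rw [e, norm_add_sq_real] at h1
  rw [real_inner_smul_left, ← neg_sub x (z x), inner_neg_left]
  linarith

theorem supConv_le (hD : IsCompact D) (hne : D.Nonempty) (hv : ContinuousOn v D) (hN : 0 ≤ N)
    {c : ℝ} (hc : ∀ z ∈ D, v z ≤ c) (x : F) : supConv D N v x ≤ c := by
  obtain ⟨z, hz, hzs⟩ := exists_supConv_eq hD hne hv N x
  rw [hzs]
  have := hc z hz
  have : 0 ≤ N / 2 * ‖x - z‖ ^ 2 := by positivity
  linarith

theorem self_le_supConv (hD : IsCompact D) (hv : ContinuousOn v D) (N : ℝ) {x : F} (hx : x ∈ D) :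
    v x ≤ supConv D N v x := by
  simpa using le_supConv hD hv N x hx

/-- A second-order expansion of the sup-convolution bounds the function from above near a
maximizer. -/
theorem HasTaylor.exists_le_of_supConv (hD : IsCompact D) (hv : ContinuousOn v D)
    {x z a : F} {X : F →L[ℝ] F →L[ℝ] ℝ} (hT : HasTaylor (supConv D N v) x a X)
    (hz : D ∈ 𝓝 z) (hzs : supConv D N v x = v z - N / 2 * ‖x - z‖ ^ 2) {κ : ℝ} (hκ : 0 < κ) :
    ∀ᶠ y in 𝓝 z, v y ≤ v z + inner ℝ a (y - z) + 1 / 2 * X (y - z) (y - z)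
      + κ * ‖y - z‖ ^ 2 := by
  have ht : Tendsto (fun y => y - z) (𝓝 z) (𝓝 0) := by
    have : Continuous fun y : F => y - z := by fun_prop
    simpa using this.tendsto z
  filter_upwards [ht.eventually (hT κ hκ), hz] with y hy hyD
  have h1 := le_supConv hD hv N (x + (y - z)) hyD
  rw [show x + (y - z) - y = x - z by abel] at h1
  have := (abs_le.1 hy).2
  linarith

/-- For large `N`, the sup-convolution is close to the function. -/
theorem exists_supConv_le_add (hD : IsCompact D) (hne : D.Nonempty) (hv : ContinuousOn v D)
    {c : ℝ} (hc : ∀ z ∈ D, |v z| ≤ c) {η : ℝ} (hη : 0 < η) :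
    ∃ N₀ > 0, ∀ N ≥ N₀, (∀ x ∈ D, supConv D N v x ≤ v x + η) ∧
      ∀ x ∈ D, ∀ z ∈ D, supConv D N v x = v z - N / 2 * ‖x - z‖ ^ 2 → ‖x - z‖ ≤ η := by
  have huc := hD.uniformContinuousOn_of_continuous hv
  obtain ⟨d, hd, hdv⟩ := Metric.uniformContinuousOn_iff.1 huc η hη
  set e := min (d / 2) η with he
  have he0 : 0 < e := by positivity
  have hc0 : 0 ≤ c := by
    obtain ⟨z, hz⟩ := hne; exact (abs_nonneg _).trans (hc z hz)
  -- Then (N/2)e² ≥ 2(c + 1), more than the oscillation 2c of v, so a maximizer farther than e away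
  -- would lose to z = x.
  refine ⟨4 * (c + 1) / e ^ 2, by positivity, fun N hN => ?_⟩
  have key : ∀ x ∈ D, ∀ z ∈ D, supConv D N v x = v z - N / 2 * ‖x - z‖ ^ 2 → ‖x - z‖ ≤ e := by
    intro x hx z hz hzs
    by_contra hcon
    push Not at hcon
    have h1 := self_le_supConv hD hv N hx
    rw [hzs] at h1
    have h2 := (abs_le.1 (hc x hx)).1
    have h3 := (abs_le.1 (hc z hz)).2
    have h4 : e ^ 2 ≤ ‖x - z‖ ^ 2 := pow_le_pow_left₀ he0.le hcon.le 2
    have h5 : 4 * (c + 1) ≤ N * e ^ 2 := by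
      rwa [ge_iff_le, div_le_iff₀ (by positivity)] at hN
    have hN0 : 0 ≤ N := le_trans (by positivity) hN
    have h6 := mul_le_mul_of_nonneg_left h4 hN0
    linarith
  refine ⟨fun x hx => ?_, fun x hx z hz hzs => (key x hx z hz hzs).trans (min_le_right _ _)⟩
  obtain ⟨z, hz, hzs⟩ := exists_supConv_eq hD hne hv N x
  have h1 := key x hx z hz hzs
  have h2 := hdv z hz x hx (by
    rw [dist_comm, dist_eq_norm]
    have := min_le_left (d / 2) η
    linarith)
  rw [Real.dist_eq] at h2
  have hN0 : 0 ≤ N := le_trans (by positivity) hN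
  have : 0 ≤ N / 2 * ‖x - z‖ ^ 2 := by positivity
  rw [hzs]
  linarith [(abs_lt.1 h2).2]

end SupConvolution

/-! ### Quadratic test functions. -/

section Quadratic

variable {F : Type*} [NormedAddCommGroup F] [InnerProductSpace ℝ F]

/-- The quadratic function with value `c`, gradient `a` and Hessian `X` at `x₀`. -/
noncomputable def quad (x₀ : F) (c : ℝ) (a : F) (X : F →L[ℝ] F →L[ℝ] ℝ)
    (y : F) : ℝ :=
  c + inner ℝ a (y - x₀) + 1 / 2 * X (y - x₀) (y - x₀)

theorem contDiff_quad (x₀ : F) (c : ℝ) (a : F) (X : F →L[ℝ] F →L[ℝ] ℝ) :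
    ContDiff ℝ 2 (quad x₀ c a X) := by
  have h1 : ContDiff ℝ 2 fun y : F => X (y - x₀) (y - x₀) :=
    (X.contDiff.comp (contDiff_id.sub contDiff_const)).clm_apply (contDiff_id.sub contDiff_const)
  have h2 : ContDiff ℝ 2 fun y : F => inner ℝ a (y - x₀) :=
    contDiff_const.inner ℝ (contDiff_id.sub contDiff_const)
  exact (contDiff_const.add h2).add (contDiff_const.mul h1)

/-- X need not be symmetric, so its symmetrization appears; diagonal values X v v are unaffected. -/
theorem fderiv_quad (x₀ : F) (c : ℝ) (a : F) (X : F →L[ℝ] F →L[ℝ] ℝ) :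
    fderiv ℝ (quad x₀ c a X) = fun y => innerBilin F a +
      (1 / 2 : ℝ) • (X (y - x₀) + X.flip (y - x₀)) := by
  funext y
  apply HasFDerivAt.fderiv
  have hs : HasFDerivAt (fun y : F => y - x₀) (ContinuousLinearMap.id ℝ F) y :=
    (hasFDerivAt_id y).sub_const x₀
  have h1 := (X.hasFDerivAt.comp y hs).clm_apply hs
  have h2 := (innerBilin F a).hasFDerivAt.comp y hs
  have h3 := (h2.const_add c).add (h1.const_mul (1 / 2 : ℝ))
  refine h3.congr_fderiv ?_
  ext h
  simp

theorem fderiv_fderiv_quad (x₀ : F) (c : ℝ) (a : F) (X : F →L[ℝ] F →L[ℝ] ℝ)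
    (y : F) :
    fderiv ℝ (fderiv ℝ (quad x₀ c a X)) y = (1 / 2 : ℝ) • (X + X.flip) := by
  rw [fderiv_quad]
  apply HasFDerivAt.fderiv
  have hs : HasFDerivAt (fun y : F => y - x₀) (ContinuousLinearMap.id ℝ F) y :=
    (hasFDerivAt_id y).sub_const x₀
  have h1 := (X.hasFDerivAt.comp y hs).add (X.flip.hasFDerivAt.comp y hs)
  have h3 := (h1.const_smul (1 / 2 : ℝ)).const_add (innerBilin F a)
  refine h3.congr_fderiv ?_
  ext h k
  simp only [smul_apply, add_apply, ContinuousLinearMap.comp_apply, ContinuousLinearMap.id_apply]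

theorem gradient_quad [CompleteSpace F] (x₀ : F) (c : ℝ) (a : F) (X : F →L[ℝ] F →L[ℝ] ℝ) :
    gradient (quad x₀ c a X) x₀ = a := by
  unfold gradient
  rw [fderiv_quad]
  simp only [sub_self, map_zero, add_zero, smul_zero]
  apply ext_inner_right ℝ
  intro h
  rw [InnerProductSpace.toDual_symm_apply]
  rfl

end Quadratic

/-! ### From viscosity solutions to one-sided inequalities for quadratic jets. -/

section JetClass

variable {n : ℕ}

/-- `tr X + (p - 2) ⟨X â, â⟩` with `â = a / |a|`. -/
noncomputable def trA (p : ℝ) (a : Euc n) (X : Euc n →L[ℝ] Euc n →L[ℝ] ℝ) : ℝ :=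
  ∑ i, X (EuclideanSpace.basisFun (Fin n) ℝ i) (EuclideanSpace.basisFun (Fin n) ℝ i) +
    (p - 2) * X (‖a‖⁻¹ • a) (‖a‖⁻¹ • a)

/-- Functions which satisfy
`|a|^θ (tr X + (p - 2) ⟨X â, â⟩) ≤ b |a|^(1 + θ) + c |a|^σ + d` at each point of `Ω` at which a
quadratic function with gradient `a ≠ 0` and Hessian `X` touches from below. -/
def JetSuper (p θ σ b c d : ℝ) (Ω : Set (Euc n)) (v : Euc n → ℝ) : Prop :=
  ∀ x ∈ Ω, ∀ a : Euc n, a ≠ 0 → ∀ X : Euc n →L[ℝ] Euc n →L[ℝ] ℝ,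
    (∀ᶠ y in 𝓝 x, v x + inner ℝ a (y - x) + 1 / 2 * X (y - x) (y - x) ≤ v y) →
    ‖a‖ ^ θ * trA p a X ≤ b * ‖a‖ ^ (1 + θ) + c * ‖a‖ ^ σ + d

theorem trA_neg (p : ℝ) (a : Euc n) (X : Euc n →L[ℝ] Euc n →L[ℝ] ℝ) :
    trA p (-a) (-X) = -trA p a X := by
  simp only [trA, norm_neg, smul_neg, map_neg, neg_apply, neg_neg, Finset.sum_neg_distrib]
  ring

theorem normPLap_quad (p : ℝ) (x₀ : Euc n) (c : ℝ) (a : Euc n)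
    (X : Euc n →L[ℝ] Euc n →L[ℝ] ℝ) : normPLap p (quad x₀ c a X) x₀ = trA p a X := by
  have hh : ∀ v, hess (quad x₀ c a X) x₀ v v = X v v := by
    intro v
    rw [hess, fderiv_fderiv_quad]
    simp only [smul_apply, add_apply, ContinuousLinearMap.flip_apply, smul_eq_mul]
    ring
  unfold normPLap trA
  rw [gradient_quad, hh,
    InnerProductSpace.laplacian_eq_iteratedFDeriv_orthonormalBasis _
      (EuclideanSpace.basisFun (Fin n) ℝ)]
  congr 1
  refine Finset.sum_congr rfl fun i _ => ?_
  rw [iteratedFDeriv_two_apply]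
  exact hh _

theorem abs_hamiltonian_le {θ σ b c : ℝ} {B : Euc n → Euc n} {ϱ : Euc n → ℝ} {ξ x : Euc n}
    (hξ : ξ ≠ 0) (hB : ‖B x‖ ≤ b) (hϱ : |ϱ x| ≤ c) :
    |hamiltonian θ σ B ϱ ξ x| ≤ b * ‖ξ‖ ^ (1 + θ) + c * ‖ξ‖ ^ σ := by
  have hpos : 0 < ‖ξ‖ := norm_pos_iff.2 hξ
  unfold hamiltonian
  refine (abs_add_le _ _).trans (add_le_add ?_ ?_)
  · rw [abs_mul, abs_of_nonneg (Real.rpow_nonneg hpos.le θ), Real.rpow_add hpos, Real.rpow_one,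
      ← mul_assoc]
    refine mul_le_mul_of_nonneg_right ?_ (Real.rpow_nonneg hpos.le θ)
    exact (abs_real_inner_le_norm _ _).trans (mul_le_mul_of_nonneg_right hB hpos.le)
  · rw [abs_mul, abs_of_nonneg (Real.rpow_nonneg hpos.le σ)]
    exact mul_le_mul_of_nonneg_right hϱ (Real.rpow_nonneg hpos.le σ)

theorem IsViscositySupersolution.jetSuper {κ p θ σ b c d : ℝ} {B : Euc n → Euc n}
    {ϱ f u : Euc n → ℝ} {Ω : Set (Euc n)}
    (h : IsViscositySupersolution κ p θ σ B ϱ f Ω u) (hB : ∀ x ∈ Ω, ‖B x‖ ≤ b)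
    (hϱ : ∀ x ∈ Ω, |ϱ x| ≤ c) (hf : ∀ x ∈ Ω, |f x| ≤ d) : JetSuper p θ σ b c d Ω u := by
  intro x hx a ha X hX
  have hmin : IsLocalMin (fun y => u y - quad x (u x) a X y) x := by
    filter_upwards [hX] with y hy
    simp only [quad, sub_self, inner_zero_right, map_zero, mul_zero, add_zero]
    linarith
  have h1 := (h _ (contDiff_quad x (u x) a X).contDiffOn x hx hmin).1
    (by rwa [gradient_quad])
  rw [gradient_quad, normPLap_quad] at h1
  have h2 := (abs_le.1 (abs_hamiltonian_le (θ := θ) (σ := σ) ha (hB x hx) (hϱ x hx))).1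
  have h3 := (abs_le.1 (hf x hx)).2
  linarith

theorem IsViscositySubsolution.jetSuper_neg {κ p θ σ b c d : ℝ} {B : Euc n → Euc n}
    {ϱ f u : Euc n → ℝ} {Ω : Set (Euc n)}
    (h : IsViscositySubsolution κ p θ σ B ϱ f Ω u) (hB : ∀ x ∈ Ω, ‖B x‖ ≤ b)
    (hϱ : ∀ x ∈ Ω, |ϱ x| ≤ c) (hf : ∀ x ∈ Ω, |f x| ≤ d) :
    JetSuper p θ σ b c d Ω (fun y => -u y) := by
  intro x hx a ha X hX
  have hmax : IsLocalMax (fun y => u y - quad x (u x) (-a) (-X) y) x := by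
    filter_upwards [hX] with y hy
    simp only [quad, sub_self, inner_zero_right, map_zero, mul_zero, add_zero, inner_neg_left,
      neg_apply]
    linarith
  have h1 := (h _ (contDiff_quad x (u x) (-a) (-X)).contDiffOn x hx hmax).1
    (by rw [gradient_quad]; exact neg_ne_zero.2 ha)
  rw [gradient_quad, normPLap_quad, trA_neg, norm_neg] at h1
  have h2 := (abs_le.1 (abs_hamiltonian_le (θ := θ) (σ := σ) (neg_ne_zero.2 ha) (hB x hx)
    (hϱ x hx))).2
  rw [norm_neg] at h2
  have h3 := (abs_le.1 (hf x hx)).1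
  linarith

end JetClass

/-! ### The trace estimate by reflection coupling. -/

section Coupling

variable {n : ℕ}

local notation "𝐛" => EuclideanSpace.basisFun (Fin n) ℝ

theorem sum_inner_sq (α : Euc n) : ∑ i, inner ℝ α (𝐛 i) ^ 2 = ‖α‖ ^ 2 := by
  rw [← (𝐛).sum_sq_norm_inner_left α]
  simp

theorem sum_inner_mul_inner (α β : Euc n) :
    ∑ i, inner ℝ α (𝐛 i) * inner ℝ β (𝐛 i) = inner ℝ α β := by
  rw [← (𝐛).sum_inner_mul_inner α β]
  exact Finset.sum_congr rfl fun i _ => by rw [real_inner_comm (𝐛 i) β]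

theorem sum_smul_basis (α : Euc n) : ∑ i, inner ℝ α (𝐛 i) • (𝐛 i) = α := by
  conv_rhs => rw [← (𝐛).sum_repr' α]
  exact Finset.sum_congr rfl fun i _ => by rw [real_inner_comm]

/-- Splitting off the direction α leaves the tangential trace, of weight 1, and the radial part,
whose weight p − 1 is the source of ellipticity. -/
theorem trA_eq_sum_proj (p : ℝ) (a : Euc n) (X : Euc n →L[ℝ] Euc n →L[ℝ] ℝ) {α : Euc n}
    (hα : ‖a‖⁻¹ • a = α) (h1 : ‖α‖ = 1) :
    trA p a X = ∑ i, X (𝐛 i - inner ℝ α (𝐛 i) • α) (𝐛 i - inner ℝ α (𝐛 i) • α) +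
      (p - 1) * X α α := by
  have e : ∀ i, X (𝐛 i - inner ℝ α (𝐛 i) • α) (𝐛 i - inner ℝ α (𝐛 i) • α) =
      X (𝐛 i) (𝐛 i) - X α (inner ℝ α (𝐛 i) • 𝐛 i) - X (inner ℝ α (𝐛 i) • 𝐛 i) α +
        inner ℝ α (𝐛 i) ^ 2 * X α α := by
    intro i
    simp only [map_sub, map_smul, sub_apply, smul_apply, smul_eq_mul]
    ring
  simp_rw [e]
  rw [Finset.sum_add_distrib, Finset.sum_sub_distrib, Finset.sum_sub_distrib, ← map_sum,
    ← sum_apply, ← map_sum, sum_smul_basis, ← Finset.sum_mul, sum_inner_sq, h1]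
  unfold trA
  rw [hα]
  ring

/-- The reflection coupling estimate for the difference of the traces. -/
theorem trA_sub_trA_le {p : ℝ} (hp : 1 < p) {a b e : Euc n} {X Y : Euc n →L[ℝ] Euc n →L[ℝ] ℝ}
    {s m ρ τ : ℝ} (hs : 0 ≤ s) (hm : 0 ≤ m) (hρ : 0 ≤ ρ)
    (hXY : ∀ h k, X h h - Y k k ≤ s * (‖h - k‖ ^ 2 - 3 / 2 * inner ℝ e (h - k) ^ 2) +
      m * ‖h‖ ^ 2 + ρ * (‖h‖ ^ 2 + ‖k‖ ^ 2)) (ha : a ≠ 0) (hb : b ≠ 0) (he : ‖e‖ = 1)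
    (hae : ‖‖a‖⁻¹ • a - e‖ ^ 2 ≤ τ) (hbe : ‖‖b‖⁻¹ • b - e‖ ^ 2 ≤ τ) (hτ : 16 * τ ≤ p - 1)
    (hτ' : 12 * τ ≤ 1) :
    trA p a X - trA p b Y ≤ -(p - 1) * s + (m + 2 * ρ) * (n + p) := by
  obtain ⟨α, hα⟩ : ∃ α, ‖a‖⁻¹ • a = α := ⟨_, rfl⟩
  obtain ⟨β, hβ⟩ : ∃ β, ‖b‖⁻¹ • b = β := ⟨_, rfl⟩
  have hα1 : ‖α‖ = 1 := by
    rw [← hα, norm_smul, norm_inv, norm_norm, inv_mul_cancel₀ (norm_ne_zero_iff.2 ha)]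
  have hβ1 : ‖β‖ = 1 := by
    rw [← hβ, norm_smul, norm_inv, norm_norm, inv_mul_cancel₀ (norm_ne_zero_iff.2 hb)]
  rw [trA_eq_sum_proj p a X hα hα1, trA_eq_sum_proj p b Y hβ hβ1]
  rw [hα] at hae
  rw [hβ] at hbe
  -- inner products of the unit vectors
  have iαe : 1 - τ / 2 ≤ inner ℝ e α := by
    rw [norm_sub_sq_real, hα1, he, real_inner_comm] at hae; linarith
  have iβe : 1 - τ / 2 ≤ inner ℝ e β := by
    rw [norm_sub_sq_real, hβ1, he, real_inner_comm] at hbe; linarith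
  have hτ0 : 0 ≤ τ := (sq_nonneg _).trans hae
  have iαβ : 1 - 2 * τ ≤ inner ℝ α β := by
    have h1 : ‖α - β‖ ^ 2 ≤ 4 * τ := by
      have e1 : α - β = (α - e) - (β - e) := by abel
      have e2 := parallelogram_law_with_norm ℝ (α - e) (β - e)
      rw [e1]
      nlinarith [sq_nonneg ‖α - e + (β - e)‖]
    rw [norm_sub_sq_real, hα1, hβ1] at h1
    linarith
  have iαβ' : inner ℝ α β ≤ 1 := by
    have := real_inner_le_norm α β
    rwa [hα1, hβ1, one_mul] at this
  set c := inner ℝ α β with hc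
  -- the tangential part
  have hsum : ∑ i, X (𝐛 i - inner ℝ α (𝐛 i) • α) (𝐛 i - inner ℝ α (𝐛 i) • α) -
      ∑ i, Y (𝐛 i - inner ℝ β (𝐛 i) • β) (𝐛 i - inner ℝ β (𝐛 i) • β) ≤
      s * (2 - 2 * c ^ 2) + (m + 2 * ρ) * n := by
    rw [← Finset.sum_sub_distrib]
    have hi : ∀ i ∈ Finset.univ,
        X (𝐛 i - inner ℝ α (𝐛 i) • α) (𝐛 i - inner ℝ α (𝐛 i) • α) -
        Y (𝐛 i - inner ℝ β (𝐛 i) • β) (𝐛 i - inner ℝ β (𝐛 i) • β) ≤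
        s * (inner ℝ α (𝐛 i) ^ 2 + inner ℝ β (𝐛 i) ^ 2 -
          2 * c * (inner ℝ α (𝐛 i) * inner ℝ β (𝐛 i))) + (m + 2 * ρ) := by
      intro i _
      refine (hXY _ _).trans ?_
      have n1 : ∀ γ : Euc n, ‖γ‖ = 1 → ‖𝐛 i - inner ℝ γ (𝐛 i) • γ‖ ^ 2 ≤ 1 := by
        intro γ hγ
        rw [norm_sub_sq_real, inner_smul_right, norm_smul, hγ, (𝐛).norm_eq_one,
          real_inner_comm, Real.norm_eq_abs, mul_one, sq_abs]
        nlinarith [sq_nonneg (inner ℝ (𝐛 i) γ)]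
      have n2 : ‖𝐛 i - inner ℝ α (𝐛 i) • α - (𝐛 i - inner ℝ β (𝐛 i) • β)‖ ^ 2 =
          inner ℝ α (𝐛 i) ^ 2 + inner ℝ β (𝐛 i) ^ 2 -
          2 * c * (inner ℝ α (𝐛 i) * inner ℝ β (𝐛 i)) := by
        rw [sub_sub_sub_cancel_left, norm_sub_sq_real, inner_smul_left, inner_smul_right,
          norm_smul, norm_smul, hα1, hβ1, real_inner_comm α β, ← hc, mul_one, mul_one,
          Real.norm_eq_abs, Real.norm_eq_abs, sq_abs, sq_abs]
        simp only [conj_trivial]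
        ring
      rw [n2]
      have m1 := mul_le_mul_of_nonneg_left (n1 α hα1) hm
      have m2 := mul_le_mul_of_nonneg_left (n1 α hα1) hρ
      have m3 := mul_le_mul_of_nonneg_left (n1 β hβ1) hρ
      have m4 := mul_nonneg hs (sq_nonneg (inner ℝ e
        (𝐛 i - inner ℝ α (𝐛 i) • α - (𝐛 i - inner ℝ β (𝐛 i) • β))))
      linarith
    refine (Finset.sum_le_sum hi).trans (le_of_eq ?_)
    rw [Finset.sum_add_distrib, ← Finset.mul_sum, Finset.sum_sub_distrib, Finset.sum_add_distrib,
      ← Finset.mul_sum, sum_inner_sq, sum_inner_sq, sum_inner_mul_inner, hα1, hβ1]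
    simp
    ring
  -- the radial part
  have hrad : X α α - Y β β ≤ s * (-2 + 6 * τ) + (m + 2 * ρ) := by
    -- The reflected choice makes h − k = α + β close to 2e, where ‖·‖² − (3/2)⟨e, ·⟩² is close to 4
    -- − 6 = −2.
    have h1 := hXY α (-β)
    simp only [map_neg, neg_apply, neg_neg, sub_neg_eq_add, norm_neg, hα1, hβ1] at h1
    rw [norm_add_sq_real, hα1, hβ1, inner_add_right, ← hc] at h1
    have h2 : (2 - τ) ^ 2 ≤ (inner ℝ e α + inner ℝ e β) ^ 2 :=
      pow_le_pow_left₀ (by linarith) (by linarith) 2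
    have h3 : 1 ^ 2 + 2 * c + 1 ^ 2 - 3 / 2 * (inner ℝ e α + inner ℝ e β) ^ 2 ≤ -2 + 6 * τ := by
      nlinarith [sq_nonneg τ]
    have := mul_le_mul_of_nonneg_left h3 hs
    linarith
  have hp1 : 0 ≤ p - 1 := by linarith
  have h4 := mul_le_mul_of_nonneg_left hrad hp1
  have h5 : 2 - 2 * c ^ 2 ≤ 8 * τ := by nlinarith [mul_nonneg hτ0 hτ0]
  have h6 := mul_le_mul_of_nonneg_left h5 hs
  -- The smallness of τ enters here: 8τ ≤ (p − 1)/2 and 6τ ≤ 1/2.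
  have h7 : 8 * τ + (p - 1) * (-2 + 6 * τ) ≤ -(p - 1) := by nlinarith
  have h8 := mul_le_mul_of_nonneg_left h7 hs
  have h9 : 0 ≤ m + 2 * ρ := by positivity
  nlinarith

end Coupling

/-! ### Second-order expansion of the square root of the norm. -/

section SqrtNorm

variable {F : Type*} [NormedAddCommGroup F] [InnerProductSpace ℝ F]

/-- An upper bound for (1 + τ)^(1/4) in polynomial form: √‖d + h‖ is the fourth root of ‖d + h‖²,
which is quadratic in h. -/
theorem fourth_root_taylor_le {ε : ℝ} (hε : 0 < ε) (hε1 : ε ≤ 1 / 32) {τ : ℝ}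
    (hτ : |τ| ≤ ε) :
    0 ≤ 1 + (τ / 4 - 3 / 32 * τ ^ 2 + ε * τ ^ 2) ∧
      1 + τ ≤ (1 + (τ / 4 - 3 / 32 * τ ^ 2 + ε * τ ^ 2)) ^ 4 := by
  obtain ⟨h1, h2⟩ := abs_le.1 hτ
  set c := ε - 3 / 32 with hc
  have hc1 : |c| ≤ 3 / 32 := by rw [abs_le, hc]; constructor <;> linarith
  set q := τ / 4 - 3 / 32 * τ ^ 2 + ε * τ ^ 2 with hq
  have hq' : q = τ * (1 / 4 + c * τ) := by rw [hq, hc]; ring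
  have hcτ : |c * τ| ≤ 1 / 100 := by
    rw [abs_mul]
    nlinarith [abs_nonneg c, abs_nonneg τ]
  obtain ⟨h3, h4⟩ := abs_le.1 hcτ
  have hqa : |q| ≤ 3 / 10 * |τ| := by
    rw [hq', abs_mul, mul_comm]
    refine mul_le_mul_of_nonneg_right ?_ (abs_nonneg _)
    rw [abs_le]; constructor <;> linarith
  have hq3 : -(27 / 1000 * |τ| ^ 3) ≤ q ^ 3 := by
    have : |q| ^ 3 ≤ (3 / 10 * |τ|) ^ 3 := pow_le_pow_left₀ (abs_nonneg _) hqa 3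
    rw [← abs_pow] at this
    have := (abs_le.1 this).1
    nlinarith
  have hτ3 : |τ| ^ 3 ≤ ε * τ ^ 2 := by
    rw [← sq_abs τ]
    nlinarith [mul_le_mul_of_nonneg_right hτ (sq_nonneg |τ|)]
  have hcτ3 : -(3 / 32 * |τ| ^ 3) ≤ c * τ ^ 3 := by
    have : |c * τ ^ 3| ≤ 3 / 32 * |τ| ^ 3 := by
      rw [abs_mul, abs_pow]; exact mul_le_mul_of_nonneg_right hc1 (by positivity)
    exact (abs_le.1 this).1
  have hq2 : 6 * q ^ 2 ≥ 3 / 8 * τ ^ 2 + 3 * (c * τ ^ 3) := by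
    rw [hq']
    nlinarith [sq_nonneg (c * τ ^ 2)]
  have hq4 : 0 ≤ q ^ 4 := by positivity
  have hετ : 0 ≤ ε * τ ^ 2 := by positivity
  constructor
  · have := (abs_le.1 hqa).1
    linarith
  · have e : (1 + q) ^ 4 = 1 + 4 * q + 6 * q ^ 2 + 4 * q ^ 3 + q ^ 4 := by ring
    rw [e]
    linarith

/-- Second-order upper expansion of `x ↦ √‖x‖`. -/
theorem eventually_sqrt_norm_add_le {d : F} (hd : d ≠ 0) {κ : ℝ} (hκ : 0 < κ) :
    ∀ᶠ h in 𝓝 (0 : F), √‖d + h‖ ≤ √‖d‖ + (2 * √‖d‖ ^ 3)⁻¹ *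
      (inner ℝ d h + 1 / 2 * (‖h‖ ^ 2 - 3 / 2 * inner ℝ (‖d‖⁻¹ • d) h ^ 2)) + κ * ‖h‖ ^ 2 := by
  have hd0 : 0 < ‖d‖ := norm_pos_iff.2 hd
  obtain ⟨y, hy⟩ : ∃ y, √‖d‖ = y := ⟨_, rfl⟩
  have hy0 : 0 < y := by rw [← hy]; exact Real.sqrt_pos.2 hd0
  have hdy : ‖d‖ = y ^ 2 := by rw [← hy, Real.sq_sqrt hd0.le]
  -- The ε-error then uses at most half of the allowance κy⁷‖h‖², leaving the rest for the cubic
  -- terms.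
  set ε := min (1 / 32) (κ * y ^ 7 / (2 * (2 * ‖d‖ + 1) ^ 2)) with hε
  have hε0 : 0 < ε := by positivity
  have hε2 : ε * (2 * ‖d‖ + 1) ^ 2 ≤ κ * y ^ 7 / 2 := by
    have : ε ≤ _ := min_le_right _ _
    rw [le_div_iff₀ (by positivity)] at this
    linarith
  have hball : ∀ c > 0, ∀ᶠ h in 𝓝 (0 : F), ‖h‖ < c := fun c hc => by
    filter_upwards [Metric.ball_mem_nhds (0 : F) hc] with h hh
    simpa using hh
  filter_upwards [hball 1 one_pos, hball (κ * y ^ 7 / ‖d‖) (by positivity),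
    hball (ε * y ^ 4 / (2 * ‖d‖ + 1)) (by positivity)] with h h1 h2 h3
  rw [lt_div_iff₀ hd0] at h2
  rw [lt_div_iff₀ (by positivity)] at h3
  rw [hy]
  set i := inner ℝ d h with hi
  obtain ⟨j1, j2⟩ := abs_le.1 (abs_real_inner_le_norm d h)
  rw [← hi] at j1 j2
  have hh0 := norm_nonneg h
  set t := 2 * i + ‖h‖ ^ 2 with ht
  have htb : |t| ≤ (2 * ‖d‖ + 1) * ‖h‖ := by
    rw [abs_le]; constructor <;> nlinarith
  have hτ : |t / y ^ 4| ≤ ε := by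
    rw [abs_div, abs_of_pos (by positivity : 0 < y ^ 4), div_le_iff₀ (by positivity)]
    linarith
  obtain ⟨k1, k2⟩ := fourth_root_taylor_le hε0 (min_le_left _ _) hτ
  set q := t / y ^ 4 / 4 - 3 / 32 * (t / y ^ 4) ^ 2 + ε * (t / y ^ 4) ^ 2 with hq
  have h4 : √‖d + h‖ ≤ y * (1 + q) := by
    refine le_of_pow_le_pow_left₀ (n := 4) (by norm_num) (by positivity) ?_
    have e1 : √‖d + h‖ ^ 4 = ‖d + h‖ ^ 2 := by
      rw [show (4 : ℕ) = 2 * 2 from rfl, pow_mul, Real.sq_sqrt (norm_nonneg _)]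
    have e2 : ‖d + h‖ ^ 2 = y ^ 4 * (1 + t / y ^ 4) := by
      rw [norm_add_sq_real, hdy, ht]; field_simp; ring
    rw [e1, e2, mul_pow]
    exact mul_le_mul_of_nonneg_left k2 (by positivity)
  refine h4.trans ?_
  have e3 : inner ℝ (‖d‖⁻¹ • d) h = i / y ^ 2 := by
    rw [real_inner_smul_left, hdy, ← hi]; field_simp
  rw [e3]
  have h5 : t ^ 2 ≤ (2 * ‖d‖ + 1) ^ 2 * ‖h‖ ^ 2 := by
    rw [← sq_abs t, ← mul_pow]; exact pow_le_pow_left₀ (abs_nonneg _) htb 2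
  have h6 : -(3 / 32) * t ^ 2 + ε * t ^ 2 ≤ -(3 / 8) * i ^ 2 + κ * y ^ 7 * ‖h‖ ^ 2 := by
    have a1 := mul_le_mul_of_nonneg_left h5 hε0.le
    have a2 := mul_le_mul_of_nonneg_right hε2 (sq_nonneg ‖h‖)
    have a3 := mul_le_mul_of_nonneg_right h2.le (sq_nonneg ‖h‖)
    have a4 : t ^ 2 ≥ 4 * i ^ 2 + 4 * i * ‖h‖ ^ 2 := by rw [ht]; nlinarith [sq_nonneg (‖h‖ ^ 2)]
    have a5 := mul_le_mul_of_nonneg_right j1 (sq_nonneg ‖h‖)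
    have a6 : 0 ≤ κ * y ^ 7 * ‖h‖ ^ 2 := by positivity
    linarith only [a1, a2, a3, a4, a5, a6]
  have h7 : y * (1 + q) = y + (t / 4 * y ^ 4 + (-(3 / 32) * t ^ 2 + ε * t ^ 2)) / y ^ 7 := by
    rw [hq]; field_simp; ring
  have h8 : y + (2 * y ^ 3)⁻¹ * (i + 1 / 2 * (‖h‖ ^ 2 - 3 / 2 * (i / y ^ 2) ^ 2)) + κ * ‖h‖ ^ 2 =
      y + (t / 4 * y ^ 4 + (-(3 / 8) * i ^ 2 + κ * y ^ 7 * ‖h‖ ^ 2)) / y ^ 7 := by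
    rw [ht]; field_simp; ring
  rw [h7, h8]
  gcongr

end SqrtNorm

/-! ### Doubling of variables. -/

section Doubling

variable {F : Type*} [NormedAddCommGroup F] [InnerProductSpace ℝ F]

/-- The Hessian of `x ↦ 2 s ‖d‖ ^ (3 / 2) √‖x‖` at a point in direction `e`, plus a small multiple
of the identity. -/
noncomputable def sqrtHess (s : ℝ) (e : F) : F →L[ℝ] F →L[ℝ] ℝ :=
  (s + 1 / 16) • innerBilin F - (3 / 2 * s) • (innerBilin F e).smulRight (innerBilin F e)

theorem sqrtHess_apply (s : ℝ) (e h k : F) :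
    sqrtHess s e h k = (s + 1 / 16) * inner ℝ h k - 3 / 2 * s * (inner ℝ e h * inner ℝ e k) :=
  rfl

/-- Expanding √‖·‖ off the origin turns the maximum into contact from above with a quadratic. The
tolerance 1/(32L) becomes the 1/16 in `sqrtHess`; the penalty contributes 64(x₀ − x₁) to the
gradient and 64 to the Hessian in x. -/
theorem eventually_doubling_le {U V : F → ℝ} {L s : ℝ} (hL : 0 < L) {x₀ y₀ x₁ d : F}
    (hd : x₀ - y₀ = d) (hd0 : d ≠ 0) (hs : s = L * (2 * √‖d‖ ^ 3)⁻¹)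
    (hmax : ∀ᶠ z in 𝓝 (x₀, y₀), U z.1 - V z.2 - L * √‖z.1 - z.2‖ - 32 * ‖z.1 - x₁‖ ^ 2 ≤
      U x₀ - V y₀ - L * √‖x₀ - y₀‖ - 32 * ‖x₀ - x₁‖ ^ 2) :
    ∀ᶠ z in 𝓝 (x₀, y₀), U z.1 - V z.2 ≤ U x₀ - V y₀ +
      inner ℝ (s • d + (64 : ℝ) • (x₀ - x₁)) (z.1 - x₀) - inner ℝ (s • d) (z.2 - y₀) +
      1 / 2 * (sqrtHess s (‖d‖⁻¹ • d) (z.1 - x₀ - (z.2 - y₀)) (z.1 - x₀ - (z.2 - y₀)) +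
        64 * ‖z.1 - x₀‖ ^ 2) := by
  have hlim : Tendsto (fun z : F × F => z.1 - x₀ - (z.2 - y₀)) (𝓝 (x₀, y₀)) (𝓝 0) := by
    have : Continuous fun z : F × F => z.1 - x₀ - (z.2 - y₀) := by fun_prop
    simpa using this.tendsto (x₀, y₀)
  filter_upwards [hlim.eventually (eventually_sqrt_norm_add_le hd0
      (κ := 1 / (32 * L)) (by positivity)), hmax] with z h1 h4
  obtain ⟨h, hh⟩ : ∃ h, z.1 - x₀ = h := ⟨_, rfl⟩
  obtain ⟨k, hk⟩ : ∃ k, z.2 - y₀ = k := ⟨_, rfl⟩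
  have e1 : z.1 - z.2 = d + (h - k) := by rw [← hh, ← hk, ← hd]; abel
  have e2 : z.1 - x₁ = (x₀ - x₁) + h := by rw [← hh]; abel
  obtain ⟨e, he⟩ : ∃ e, ‖d‖⁻¹ • d = e := ⟨_, rfl⟩
  rw [hh, hk, he] at h1
  rw [e1, e2, hd, norm_add_sq_real] at h4
  rw [hh, hk, sqrtHess_apply, he, real_inner_self_eq_norm_sq, inner_add_left,
    real_inner_smul_left, real_inner_smul_left, real_inner_smul_left]
  have h5 := mul_le_mul_of_nonneg_left h1 hL.le
  have e3 : L * (√‖d‖ + (2 * √‖d‖ ^ 3)⁻¹ * (inner ℝ d (h - k) + 1 / 2 * (‖h - k‖ ^ 2 -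
      3 / 2 * inner ℝ e (h - k) ^ 2)) + 1 / (32 * L) * ‖h - k‖ ^ 2) =
      L * √‖d‖ + s * (inner ℝ d h - inner ℝ d k + 1 / 2 * (‖h - k‖ ^ 2 -
      3 / 2 * inner ℝ e (h - k) ^ 2)) + 1 / 32 * ‖h - k‖ ^ 2 := by
    rw [hs, inner_sub_right]; field_simp
  rw [e3] at h5
  linarith

/-- Second-order expansions near an off-diagonal maximum of the doubled function. -/
theorem exists_hasTaylor_doubling [FiniteDimensional ℝ F] {lam : ℝ} {U V : F → ℝ} {p₁ p₂ : F → F}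
    (hp₁ : IsLowerSlope lam U p₁) (hp₂ : IsLowerSlope lam (fun y => -V y) p₂)
    (hU : Continuous U) (hV : Continuous V) {L s : ℝ} (hL : 0 < L) {x₀ y₀ x₁ d : F}
    (hd : x₀ - y₀ = d) (hd0 : d ≠ 0) (hs : s = L * (2 * √‖d‖ ^ 3)⁻¹)
    (hmax : ∀ᶠ z in 𝓝 (x₀, y₀), U z.1 - V z.2 - L * √‖z.1 - z.2‖ - 32 * ‖z.1 - x₁‖ ^ 2 ≤
      U x₀ - V y₀ - L * √‖x₀ - y₀‖ - 32 * ‖x₀ - x₁‖ ^ 2) :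
    ∃ (x y a b : F) (X Y : F →L[ℝ] F →L[ℝ] ℝ), ‖x - x₀‖ ≤ 1 / 32 ∧ ‖y - y₀‖ ≤ 1 / 32 ∧
      ‖a - s • d‖ ≤ 64 * ‖x₀ - x₁‖ + 1 ∧ ‖b - s • d‖ ≤ 1 ∧ HasTaylor U x a X ∧ HasTaylor V y b Y ∧
      ∀ h k, X h h - Y k k ≤ s * (‖h - k‖ ^ 2 - 3 / 2 * inner ℝ (‖d‖⁻¹ • d) (h - k) ^ 2) +
        64 * ‖h‖ ^ 2 + 1 / 4 * (‖h‖ ^ 2 + ‖k‖ ^ 2) := by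
  obtain ⟨x, y, a, b, X, Y, hx, hy, ha, hb, hTx, hTy, hXY⟩ :=
    exists_hasTaylor_sub hp₁ hp₂ hU hV
      (fun h k => by rw [sqrtHess_apply, sqrtHess_apply, real_inner_comm]; ring)
      (eventually_doubling_le hL hd hd0 hs hmax) (ρ := 1 / 32) (by norm_num)
  refine ⟨x, y, a, b, X, Y, hx, hy, ?_, hb.trans (by norm_num), hTx, hTy, fun h k => ?_⟩
  · have e : a - s • d = (a - (s • d + (64 : ℝ) • (x₀ - x₁))) + (64 : ℝ) • (x₀ - x₁) := by abel
    rw [e]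
    refine (norm_add_le _ _).trans ?_
    rw [norm_smul, Real.norm_eq_abs, abs_of_pos (by norm_num : (0 : ℝ) < 64)]
    linarith
  · refine (hXY h k).trans ?_
    rw [sqrtHess_apply, real_inner_self_eq_norm_sq]
    have := parallelogram_law_with_norm ℝ h k
    nlinarith [sq_nonneg ‖h + k‖]

theorem norm_normalize_sub_le {a w : F} (hw : w ≠ 0) (ha : a ≠ 0) :
    ‖‖a‖⁻¹ • a - ‖w‖⁻¹ • w‖ ≤ 2 * ‖a - w‖ / ‖w‖ := by
  have hw0 : 0 < ‖w‖ := norm_pos_iff.2 hw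
  have ha0 : 0 < ‖a‖ := norm_pos_iff.2 ha
  rw [le_div_iff₀ hw0]
  have e : ‖w‖ • (‖a‖⁻¹ • a - ‖w‖⁻¹ • w) = (‖w‖ - ‖a‖) • (‖a‖⁻¹ • a) + (a - w) := by
    rw [smul_sub, smul_smul ‖w‖ ‖w‖⁻¹, mul_inv_cancel₀ hw0.ne', one_smul, sub_smul,
      smul_smul ‖a‖ ‖a‖⁻¹, mul_inv_cancel₀ ha0.ne', one_smul]
    abel
  have h1 : ‖‖a‖⁻¹ • a‖ = 1 := by
    rw [norm_smul, norm_inv, norm_norm, inv_mul_cancel₀ ha0.ne']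
  have h2 : ‖‖w‖ • (‖a‖⁻¹ • a - ‖w‖⁻¹ • w)‖ ≤ 2 * ‖a - w‖ := by
    rw [e]
    refine (norm_add_le _ _).trans ?_
    rw [norm_smul, h1, Real.norm_eq_abs, mul_one, norm_sub_rev a w]
    have := abs_norm_sub_norm_le w a
    linarith
  rw [norm_smul, norm_norm] at h2
  linarith

end Doubling

/-! ### The interior Hölder estimate. -/

section Holder

variable {n : ℕ}

theorem trA_add_smul_innerBilin (p : ℝ) {a : Euc n} (ha : a ≠ 0)
    (X : Euc n →L[ℝ] Euc n →L[ℝ] ℝ) (c : ℝ) :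
    trA p a (X + c • innerBilin (Euc n)) = trA p a X + c * (n + p - 2) := by
  have h1 : ‖‖a‖⁻¹ • a‖ = 1 := by
    rw [norm_smul, norm_inv, norm_norm, inv_mul_cancel₀ (norm_ne_zero_iff.2 ha)]
  simp only [trA, add_apply, smul_apply, innerBilin_apply, smul_eq_mul,
    real_inner_self_eq_norm_sq, h1, Finset.sum_add_distrib, OrthonormalBasis.norm_eq_one]
  simp
  ring

/-- For ‖a‖ ≥ 1 every term on the right is at most ‖a‖^(1+θ), so dividing by ‖a‖^θ removes the
degeneracy. The slack ‖y − x‖² is absorbed by subtracting twice the identity from X. -/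
theorem JetSuper.trA_le {p θ σ : ℝ} {Ω : Set (Euc n)} {v : Euc n → ℝ}
    (h : JetSuper p θ σ 1 1 1 Ω v) (hθ : 0 < θ) (hσ : σ ≤ 1 + θ) {x : Euc n} (hx : x ∈ Ω)
    {a : Euc n} (ha : 1 ≤ ‖a‖) {X : Euc n →L[ℝ] Euc n →L[ℝ] ℝ}
    (hX : ∀ᶠ y in 𝓝 x, v x + inner ℝ a (y - x) + 1 / 2 * X (y - x) (y - x) - ‖y - x‖ ^ 2 ≤ v y) :
    trA p a X ≤ 3 * ‖a‖ + 2 * (n + p - 2) := by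
  have ha0 : a ≠ 0 := by rintro rfl; simp at ha; linarith
  have hpos : 0 < ‖a‖ := by linarith
  have h1 := h x hx a ha0 (X + (-2 : ℝ) • innerBilin (Euc n)) (by
    filter_upwards [hX] with y hy
    simp only [add_apply, smul_apply, innerBilin_apply, smul_eq_mul, real_inner_self_eq_norm_sq]
    linarith)
  rw [trA_add_smul_innerBilin p ha0] at h1
  have h2 : ‖a‖ ^ σ ≤ ‖a‖ ^ (1 + θ) := Real.rpow_le_rpow_of_exponent_le ha hσ
  have h3 : 1 ≤ ‖a‖ ^ (1 + θ) := Real.one_le_rpow ha (by linarith)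
  have h4 : ‖a‖ ^ (1 + θ) = ‖a‖ ^ θ * ‖a‖ := by rw [add_comm, Real.rpow_add_one hpos.ne']
  have h5 : 0 < ‖a‖ ^ θ := Real.rpow_pos_of_pos hpos θ
  have h6 : ‖a‖ ^ θ * (trA p a X + -2 * (n + p - 2)) ≤ ‖a‖ ^ θ * (3 * ‖a‖) := by
    rw [h4] at h1 h2 h3; linarith
  have := le_of_mul_le_mul_left h6 h5
  linarith

/-- An expansion of the sup-convolution at x transfers to v at the maximizer z with the same
gradient and Hessian. The bounds in `JetSuper` do not depend on the point, so moving from x to z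
costs nothing. -/
theorem le_trA_of_hasTaylor_supConv {p θ σ : ℝ} {Ω D : Set (Euc n)} {v : Euc n → ℝ} {N : ℝ}
    (h : JetSuper p θ σ 1 1 1 Ω fun y => -v y) (hθ : 0 < θ) (hσ : σ ≤ 1 + θ)
    (hD : IsCompact D) (hv : ContinuousOn v D) {x z a : Euc n}
    {X : Euc n →L[ℝ] Euc n →L[ℝ] ℝ} (hT : HasTaylor (supConv D N v) x a X) (hz : D ∈ 𝓝 z)
    (hzΩ : z ∈ Ω) (hzs : supConv D N v x = v z - N / 2 * ‖x - z‖ ^ 2) (ha : 1 ≤ ‖a‖) :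
    -(3 * ‖a‖ + 2 * (n + p - 2)) ≤ trA p a X := by
  have h1 := h.trA_le hθ hσ hzΩ (a := -a) (X := -X) (by rwa [norm_neg]) (by
    filter_upwards [hT.exists_le_of_supConv hD hv hz hzs one_pos] with y hy
    simp only [inner_neg_left, neg_apply]
    linarith)
  rw [trA_neg, norm_neg] at h1
  linarith

/-- With w = s d, both L²y² ≤ 1 and L² = T give s ≥ T‖w‖ and ‖w‖ ≥ T/2. Thus (p − 1)s from the
coupling outweighs the first-order terms, of size ‖w‖, and the constants. -/
theorem not_trA_bounds {p : ℝ} (hp : 1 < p) {q T L y s : ℝ} (hq0 : 0 < q) (hq1 : q ≤ 1)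
    (hqp : q ≤ p - 1) (hTq : T * q = 300 * (n + p + 1)) (hLT : L ^ 2 = T) (hL0 : 0 < L)
    (hy : 0 < y) (hLy : L * y < 1) (hs : s = L * (2 * y ^ 3)⁻¹) {d a b : Euc n}
    (hd : ‖d‖ = y ^ 2) {X Y : Euc n →L[ℝ] Euc n →L[ℝ] ℝ} (ha : ‖a - s • d‖ ≤ 17)
    (hb : ‖b - s • d‖ ≤ 17)
    (hXY : ∀ h k, X h h - Y k k ≤ s * (‖h - k‖ ^ 2 - 3 / 2 * inner ℝ (‖d‖⁻¹ • d) (h - k) ^ 2) +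
        64 * ‖h‖ ^ 2 + 1 / 4 * (‖h‖ ^ 2 + ‖k‖ ^ 2))
    (hX : 1 ≤ ‖a‖ → -(3 * ‖a‖ + 2 * (n + p - 2)) ≤ trA p a X)
    (hY : 1 ≤ ‖b‖ → trA p b Y ≤ 3 * ‖b‖ + 2 * (n + p - 2)) : False := by
  have hn0 : (0 : ℝ) ≤ n := Nat.cast_nonneg n
  have hT0 : 0 < T := by rw [← hLT]; positivity
  have hT600 : 600 ≤ T * q := by rw [hTq]; linarith
  have hT1 : T * q ≤ T := by nlinarith
  have hs0 : 0 < s := by rw [hs]; positivity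
  obtain ⟨w, hw⟩ : ∃ w, s • d = w := ⟨_, rfl⟩
  have hws : ‖w‖ = s * y ^ 2 := by
    rw [← hw, norm_smul, Real.norm_eq_abs, abs_of_pos hs0, hd]
  have hwL : ‖w‖ * (2 * y) = L := by rw [hws, hs]; field_simp
  have hwT : T / 2 ≤ ‖w‖ := by
    have h1 : T * y ≤ L := by rw [← hLT]; nlinarith
    have h2 : T / 2 * (2 * y) ≤ ‖w‖ * (2 * y) := by linarith
    exact le_of_mul_le_mul_right h2 (by positivity)
  have hy2 : T * y ^ 2 ≤ 1 := by
    rw [← hLT, ← mul_pow]; exact pow_le_one₀ (by positivity) hLy.le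
  have hw0 : 0 < ‖w‖ := by linarith
  have hwne : w ≠ 0 := norm_pos_iff.1 hw0
  have hdir : ‖d‖⁻¹ • d = ‖w‖⁻¹ • w := by
    rw [hws, ← hw, smul_smul, hd]; congr 1; field_simp
  rw [hw] at ha hb
  have hbd : ∀ c : Euc n, ‖c - w‖ ≤ 17 → 1 ≤ ‖c‖ ∧ ‖c‖ ≤ 2 * ‖w‖ ∧ c ≠ 0 ∧
      ‖‖c‖⁻¹ • c - ‖d‖⁻¹ • d‖ ^ 2 ≤ q / 64 := by
    intro c hc
    have h1 := abs_le.1 (abs_norm_sub_norm_le c w)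
    have h2 : 1 ≤ ‖c‖ := by linarith [h1.1]
    have hc0 : c ≠ 0 := norm_pos_iff.1 (by linarith)
    refine ⟨h2, by linarith [h1.2], hc0, ?_⟩
    rw [hdir]
    have h3 := norm_normalize_sub_le hwne hc0
    -- Since ‖w‖ ≥ T/2, the left side is at most 68/T, and Tq ≥ 600.
    have h4 : 2 * ‖c - w‖ / ‖w‖ ≤ q / 8 := by
      rw [div_le_iff₀ hw0]
      nlinarith
    have h5 := pow_le_pow_left₀ (norm_nonneg _) (h3.trans h4) 2
    nlinarith
  obtain ⟨a1, a2, a3, a4⟩ := hbd a ha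
  obtain ⟨b1, b2, b3, b4⟩ := hbd b hb
  have he1 : ‖‖d‖⁻¹ • d‖ = 1 := by
    rw [hdir, norm_smul, norm_inv, norm_norm, inv_mul_cancel₀ hw0.ne']
  have key := trA_sub_trA_le hp hs0.le (by norm_num) (by norm_num) hXY a3 b3 he1 a4 b4
    (by linarith) (by linarith)
  have hX' := hX a1
  have hY' := hY b1
  have h1 : (p - 1) * s ≤ 12 * ‖w‖ + 69 * (n + p) := by linarith
  have h2 : 600 * ‖w‖ ≤ q * s := by
    have e : q * s = q * s * 1 := by ring
    have : q * s * (T * y ^ 2) ≤ q * s * 1 := mul_le_mul_of_nonneg_left hy2 (by positivity)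
    have h3 : q * s * (T * y ^ 2) = (T * q) * ‖w‖ := by rw [hws]; ring
    have h4 := mul_le_mul_of_nonneg_right hT600 hw0.le
    linarith
  have h3 : q * s ≤ (p - 1) * s := mul_le_mul_of_nonneg_right hqp hs0.le
  have h4 : (T * q) * ‖w‖ ≤ q * s := by
    have : q * s * (T * y ^ 2) ≤ q * s * 1 := mul_le_mul_of_nonneg_left hy2 (by positivity)
    have h3 : q * s * (T * y ^ 2) = (T * q) * ‖w‖ := by rw [hws]; ring
    linarith
  rw [hTq] at h4
  nlinarith

set_option maxHeartbeats 1000000 in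
/-- Interior Hölder estimate for solutions with values in `[0, 1]`, by doubling of variables. -/
theorem exists_holder (n : ℕ) {p θ σ : ℝ} (hp : 1 < p) (hθ : 0 < θ) (hσ : σ ≤ 1 + θ) :
    ∃ L > 0, ∀ v : Euc n → ℝ, ContinuousOn v (unitBall n) →
      (∀ x ∈ unitBall n, 0 ≤ v x ∧ v x ≤ 1) → JetSuper p θ σ 1 1 1 (unitBall n) v →
      JetSuper p θ σ 1 1 1 (unitBall n) (fun y => -v y) →
      ∀ x₁ ∈ closedBall (0 : Euc n) (1 / 4), ∀ y₁ ∈ closedBall x₁ (1 / 4),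
        v x₁ - v y₁ ≤ L * √‖x₁ - y₁‖ := by
  obtain ⟨q, hq⟩ : ∃ q, q = min 1 (p - 1) := ⟨_, rfl⟩
  have hq0 : 0 < q := by rw [hq]; exact lt_min one_pos (by linarith)
  have hq1 : q ≤ 1 := hq ▸ min_le_left _ _
  have hqp : q ≤ p - 1 := hq ▸ min_le_right _ _
  have hn0 : (0 : ℝ) ≤ n := Nat.cast_nonneg n
  obtain ⟨T, hT⟩ : ∃ T, T = 300 * (n + p + 1) / q := ⟨_, rfl⟩
  have hTq : T * q = 300 * (n + p + 1) := by rw [hT]; field_simp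
  have hT0 : 0 < T := by rw [hT]; positivity
  have hT1 : 300 * (n + p + 1) ≤ T := by rw [← hTq]; nlinarith
  have hT300 : 600 ≤ T := by nlinarith
  have hLT : √T ^ 2 = T := Real.sq_sqrt hT0.le
  have hL0 : 0 < √T := Real.sqrt_pos.2 hT0
  have hL16 : 16 ≤ √T := Real.le_sqrt_of_sq_le (by linarith)
  obtain ⟨L, hL⟩ : ∃ L, √T = L := ⟨_, rfl⟩
  rw [hL] at hLT hL0 hL16
  refine ⟨L, hL0, fun v hvc hv01 hsuper hsub x₁ hx₁ y₁ hy₁ => ?_⟩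
  by_contra hcon
  push Not at hcon
  obtain ⟨m₀, hm₀⟩ : ∃ m₀, m₀ = v x₁ - v y₁ - L * √‖x₁ - y₁‖ := ⟨_, rfl⟩
  have hm₀0 : 0 < m₀ := by linarith
  have hx₁' : ‖x₁‖ ≤ 1 / 4 := by simpa using hx₁
  have hy₁' : ‖y₁ - x₁‖ ≤ 1 / 4 := by rw [← dist_eq_norm]; exact hy₁
  set D : Set (Euc n) := closedBall 0 (7 / 8) with hD
  have hDc : IsCompact D := isCompact_closedBall _ _
  have hDne : D.Nonempty := ⟨0, by rw [hD]; simp; norm_num⟩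
  have hDΩ : D ⊆ unitBall n := closedBall_subset_ball (by norm_num)
  have hvD : ContinuousOn v D := hvc.mono hDΩ
  have hvD' : ContinuousOn (fun y => -v y) D := hvD.neg
  have hmemD : ∀ x : Euc n, ‖x - x₁‖ ≤ 5 / 8 → x ∈ D := fun x hx => by
    rw [hD, mem_closedBall, dist_zero_right]
    have : x = (x - x₁) + x₁ := by abel
    rw [this]; refine (norm_add_le _ _).trans ?_; linarith
  have hnhdsD : ∀ x : Euc n, ‖x - x₁‖ < 5 / 8 → D ∈ 𝓝 x := fun x hx => by
    refine mem_of_superset (Metric.isOpen_ball.mem_nhds (x := x) (s := ball x₁ (5 / 8)) ?_) ?_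
    · rwa [mem_ball, dist_eq_norm]
    · intro y hy
      rw [mem_ball, dist_eq_norm] at hy
      exact hmemD y hy.le
  -- The bound m₀/4 excludes a maximum on the diagonal, where the doubled function is at most 2η;
  -- 1/16 keeps the sup-convolution maximizers inside D.
  obtain ⟨η, hη⟩ : ∃ η, η = min (m₀ / 4) (1 / 16) := ⟨_, rfl⟩
  have hη0 : 0 < η := by rw [hη]; positivity
  have hηm : η ≤ m₀ / 4 := hη ▸ min_le_left _ _
  have hη16 : η ≤ 1 / 16 := hη ▸ min_le_right _ _
  have hvabs : ∀ z ∈ D, |v z| ≤ 1 := fun z hz => by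
    have := hv01 z (hDΩ hz); rw [abs_le]; constructor <;> linarith
  obtain ⟨N₁, hN₁, hU⟩ := exists_supConv_le_add hDc hDne hvD hvabs hη0
  obtain ⟨N₂, hN₂, hV⟩ := exists_supConv_le_add hDc hDne hvD'
    (fun z hz => by rw [abs_neg]; exact hvabs z hz) hη0
  obtain ⟨N, hN⟩ : ∃ N, N = max N₁ N₂ := ⟨_, rfl⟩
  have hN0 : 0 ≤ N := by rw [hN]; exact hN₁.le.trans (le_max_left _ _)
  obtain ⟨hU1, hU2⟩ := hU N (hN ▸ le_max_left _ _)
  obtain ⟨hV1, hV2⟩ := hV N (hN ▸ le_max_right _ _)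
  set U := supConv D N v with hUdef
  set V' := supConv D N (fun y => -v y) with hVdef
  have hUc : Continuous U := continuous_supConv hDc hvD N
  have hVc : Continuous V' := continuous_supConv hDc hvD' N
  have hU3 : ∀ x, U x ≤ 1 := supConv_le hDc hDne hvD hN0 fun z hz => (hv01 z (hDΩ hz)).2
  have hV3 : ∀ x, V' x ≤ 0 := supConv_le hDc hDne hvD' hN0 fun z hz => by
    have := (hv01 z (hDΩ hz)).1; linarith
  have hU4 : ∀ x ∈ D, v x ≤ U x := fun x hx => self_le_supConv hDc hvD N hx
  have hV4 : ∀ x ∈ D, -v x ≤ V' x := fun x hx => self_le_supConv hDc hvD' N hx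
  -- maximum of the doubled function
  set W : Euc n × Euc n → ℝ := fun z => U z.1 + V' z.2 - L * √‖z.1 - z.2‖ - 32 * ‖z.1 - x₁‖ ^ 2
    with hW
  have hWc : Continuous W := by fun_prop
  obtain ⟨⟨x₀, y₀⟩, ⟨hx₀, hy₀⟩, hmax⟩ :=
    ((isCompact_closedBall x₁ (1 / 4)).prod (isCompact_closedBall x₁ (1 / 2))).exists_isMaxOn
      ⟨(x₁, y₁), mem_closedBall_self (by norm_num),
        closedBall_subset_closedBall (by norm_num) hy₁⟩ hWc.continuousOn
  have hWmax : ∀ x y, ‖x - x₁‖ ≤ 1 / 4 → ‖y - x₁‖ ≤ 1 / 2 → W (x, y) ≤ W (x₀, y₀) := by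
    intro x y hx hy
    rw [← dist_eq_norm] at hx hy
    exact hmax ⟨hx, hy⟩
  have hWm : m₀ ≤ W (x₀, y₀) := by
    refine le_trans ?_ (hWmax x₁ y₁ (by simp) (by linarith))
    have h1 := hU4 x₁ (hmemD _ (by simp; norm_num))
    have h2 := hV4 y₁ (hmemD _ (by linarith))
    simp only [hW, sub_self, norm_zero]
    rw [hm₀]; linarith
  have hx₀' : ‖x₀ - x₁‖ ≤ 1 / 4 := by rw [← dist_eq_norm]; exact hx₀
  have hy₀' : ‖y₀ - x₁‖ ≤ 1 / 2 := by rw [← dist_eq_norm]; exact hy₀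
  have hW0 : 0 < U x₀ + V' y₀ - L * √‖x₀ - y₀‖ - 32 * ‖x₀ - x₁‖ ^ 2 := hm₀0.trans_le hWm
  have hne : x₀ - y₀ ≠ 0 := by
    intro h0
    have hxy : y₀ = x₀ := (sub_eq_zero.1 h0).symm
    have h1 := hU1 x₀ (hmemD _ (by linarith))
    have h2 := hV1 x₀ (hmemD _ (by linarith))
    have h3 : W (x₀, y₀) ≤ 2 * η := by
      simp only [hW, hxy, sub_self, norm_zero, Real.sqrt_zero]
      nlinarith [sq_nonneg ‖x₀ - x₁‖]
    linarith
  obtain ⟨d, hd⟩ : ∃ d, x₀ - y₀ = d := ⟨_, rfl⟩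
  rw [hd] at hne hW0
  have hr0 : 0 < ‖d‖ := norm_pos_iff.2 hne
  obtain ⟨y, hy⟩ : ∃ y, √‖d‖ = y := ⟨_, rfl⟩
  have hyp : 0 < y := by rw [← hy]; exact Real.sqrt_pos.2 hr0
  have hdy : ‖d‖ = y ^ 2 := by rw [← hy, Real.sq_sqrt hr0.le]
  rw [hy] at hW0
  have hLy : L * y < 1 := by nlinarith [hU3 x₀, hV3 y₀, sq_nonneg ‖x₀ - x₁‖]
  -- On the boundary the penalty is 32/16 = 2, more than U + V' ≤ 1 allows.
  have hx₀lt : ‖x₀ - x₁‖ < 1 / 4 := by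
    have : 0 < L * y := by positivity
    by_contra hcon
    push Not at hcon
    nlinarith [hU3 x₀, hV3 y₀]
  have hy16 : y < 1 / 16 := by nlinarith
  have hy₀lt : ‖y₀ - x₁‖ < 5 / 16 := by
    have : y₀ - x₁ = (x₀ - x₁) - d := by rw [← hd]; abel
    rw [this]; refine (norm_sub_le _ _).trans_lt ?_
    rw [hdy]; nlinarith
  obtain ⟨s, hs⟩ : ∃ s, s = L * (2 * √‖d‖ ^ 3)⁻¹ := ⟨_, rfl⟩
  obtain ⟨p₁, hp₁⟩ := exists_isLowerSlope_supConv hDc hDne hvD N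
  obtain ⟨p₂, hp₂⟩ := exists_isLowerSlope_supConv hDc hDne hvD' N
  obtain ⟨x, y', a, b, X, Y, hx, hy', ha, hb, hTx, hTy, hXY⟩ :=
    exists_hasTaylor_doubling hp₁ (V := fun y => -V' y) (by simpa using hp₂) hUc hVc.neg hL0 hd hne
      hs (x₁ := x₁) (by
        have hlim1 : ∀ᶠ z : Euc n × Euc n in 𝓝 (x₀, y₀), ‖z.1 - x₁‖ < 1 / 4 :=
          (Continuous.tendsto (by fun_prop) (x₀, y₀)).eventually (gt_mem_nhds hx₀lt)
        have hlim2 : ∀ᶠ z : Euc n × Euc n in 𝓝 (x₀, y₀), ‖z.2 - x₁‖ < 5 / 16 :=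
          (Continuous.tendsto (by fun_prop) (x₀, y₀)).eventually (gt_mem_nhds hy₀lt)
        filter_upwards [hlim1, hlim2] with z h2 h3
        have h4 := hWmax z.1 z.2 h2.le (by linarith)
        simpa only [hW, sub_neg_eq_add] using h4)
  have hx₁x : ‖x - x₁‖ ≤ 9 / 32 := by
    have : x - x₁ = (x - x₀) + (x₀ - x₁) := by abel
    rw [this]; refine (norm_add_le _ _).trans ?_; linarith
  have hy₁y : ‖y' - x₁‖ ≤ 11 / 32 := by
    have : y' - x₁ = (y' - y₀) + (y₀ - x₁) := by abel
    rw [this]; refine (norm_add_le _ _).trans ?_; linarith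
  obtain ⟨z₁, hz₁, hz₁s⟩ := exists_supConv_eq hDc hDne hvD N x
  obtain ⟨z₂, hz₂, hz₂s⟩ := exists_supConv_eq hDc hDne hvD' N y'
  have hz₁x := hU2 x (hmemD _ (by linarith)) z₁ hz₁ hz₁s
  have hz₂y := hV2 y' (hmemD _ (by linarith)) z₂ hz₂ hz₂s
  have hz₁D : D ∈ 𝓝 z₁ := hnhdsD _ (by
    have : z₁ - x₁ = (x - x₁) - (x - z₁) := by abel
    rw [this]; refine (norm_sub_le _ _).trans_lt ?_; linarith)
  have hz₂D : D ∈ 𝓝 z₂ := hnhdsD _ (by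
    have : z₂ - x₁ = (y' - x₁) - (y' - z₂) := by abel
    rw [this]; refine (norm_sub_le _ _).trans_lt ?_; linarith)
  -- The gradient error 17 is 64 · (1/4) + 1.
  refine not_trA_bounds hp hq0 hq1 hqp hTq hLT hL0 hyp hLy (hy ▸ hs) hdy
    (ha.trans (by linarith)) (hb.trans (by norm_num)) hXY (fun ha1 => ?_) (fun hb1 => ?_)
  · exact le_trA_of_hasTaylor_supConv hsub hθ hσ hDc hvD hTx hz₁D (hDΩ hz₁) hz₁s ha1
  · have hTy' : HasTaylor (supConv D N fun y => -v y) y' (-b) (-Y) := by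
      simpa using hTy.neg
    have h1 := le_trA_of_hasTaylor_supConv (v := fun y => -v y) (by simpa using hsuper) hθ hσ hDc
      hvD' hTy' hz₂D (hDΩ hz₂) hz₂s (by rwa [norm_neg])
    rw [trA_neg, norm_neg] at h1
    linarith

end Holder

/-! ### The Gaussian barrier and flatness. -/

section Barrier

theorem exp_ge_quadratic {τ : ℝ} (hτ : |τ| ≤ 1) : 1 + τ + τ ^ 2 / 2 - |τ| ^ 3 ≤ Real.exp τ := by
  have h := Real.exp_bound hτ (n := 3) (by norm_num)
  simp only [Finset.sum_range_succ, Finset.sum_range_zero, Nat.factorial] at h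
  norm_num at h
  have h1 := (abs_le.1 h).1
  have : 0 ≤ |τ| ^ 3 := by positivity
  linarith

/-- The coefficient −2γ of ‖h‖² replaces the Taylor value −γ; the difference absorbs all
higher-order terms. -/
theorem eventually_gaussian_ge {F : Type*} [NormedAddCommGroup F] [InnerProductSpace ℝ F] (d : F)
    {γ : ℝ} (hγ : 0 < γ) :
    ∀ᶠ h in 𝓝 (0 : F), Real.exp (-γ * ‖d‖ ^ 2) *
      (1 - 2 * γ * inner ℝ d h + 2 * γ ^ 2 * inner ℝ d h ^ 2 - 2 * γ * ‖h‖ ^ 2) ≤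
        Real.exp (-γ * ‖d + h‖ ^ 2) := by
  obtain ⟨A, hA⟩ : ∃ A, A = γ * (2 * ‖d‖ + 1) := ⟨_, rfl⟩
  have hA0 : 0 < A := by rw [hA]; positivity
  have hball : ∀ c > 0, ∀ᶠ h in 𝓝 (0 : F), ‖h‖ < c := fun c hc => by
    filter_upwards [Metric.ball_mem_nhds (0 : F) hc] with h hh
    simpa using hh
  filter_upwards [hball 1 one_pos, hball (1 / A) (by positivity),
    hball (γ / (2 * γ ^ 2 * ‖d‖ + A ^ 3)) (by positivity)] with h h1 h2 h3
  rw [lt_div_iff₀ hA0] at h2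
  rw [lt_div_iff₀ (by positivity)] at h3
  have hh0 := norm_nonneg h
  obtain ⟨i, hi⟩ : ∃ i, inner ℝ d h = i := ⟨_, rfl⟩
  obtain ⟨j1, j2⟩ := abs_le.1 (abs_real_inner_le_norm d h)
  rw [hi] at j1 j2
  obtain ⟨τ, hτ⟩ : ∃ τ, τ = -γ * (2 * i + ‖h‖ ^ 2) := ⟨_, rfl⟩
  have hτb : |τ| ≤ A * ‖h‖ := by
    have h4 : |2 * i + ‖h‖ ^ 2| ≤ (2 * ‖d‖ + 1) * ‖h‖ := by
      rw [abs_le]; constructor <;> nlinarith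
    rw [hτ, abs_mul, abs_neg, abs_of_pos hγ, hA, mul_assoc]
    exact mul_le_mul_of_nonneg_left h4 hγ.le
  have h5 := exp_ge_quadratic (τ := τ) (by linarith)
  have h6 : |τ| ^ 3 ≤ A ^ 3 * ‖h‖ ^ 3 := by
    rw [← mul_pow]; exact pow_le_pow_left₀ (abs_nonneg _) hτb 3
  have e : -γ * ‖d + h‖ ^ 2 = -γ * ‖d‖ ^ 2 + τ := by
    rw [norm_add_sq_real, hi, hτ]; ring
  rw [e, Real.exp_add, hi]
  refine mul_le_mul_of_nonneg_left (le_trans ?_ h5) (Real.exp_pos _).le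
  have h7 : τ ^ 2 / 2 ≥ 2 * γ ^ 2 * i ^ 2 - 2 * γ ^ 2 * (‖d‖ * ‖h‖) * ‖h‖ ^ 2 := by
    have e7 : τ ^ 2 / 2 = 2 * γ ^ 2 * i ^ 2 + 2 * γ ^ 2 * i * ‖h‖ ^ 2 +
        γ ^ 2 * ‖h‖ ^ 4 / 2 := by rw [hτ]; ring
    have := mul_le_mul_of_nonneg_left j1 (by positivity : 0 ≤ 2 * γ ^ 2 * ‖h‖ ^ 2)
    have : 0 ≤ γ ^ 2 * ‖h‖ ^ 4 / 2 := by positivity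
    linarith
  have h8 := mul_le_mul_of_nonneg_right h3.le (sq_nonneg ‖h‖)
  have e8 : τ = -2 * γ * i - γ * ‖h‖ ^ 2 := by rw [hτ]; ring
  linarith

variable {n : ℕ}

/-- The rank-one part counts once in the trace and p − 2 times in the gradient direction −d/‖d‖. -/
theorem trA_gaussian (p : ℝ) {d : Euc n} (hd : d ≠ 0) {g c k : ℝ} (hg : g < 0) :
    trA p (g • d) (c • (innerBilin (Euc n) d).smulRight (innerBilin (Euc n) d) +
      k • innerBilin (Euc n)) = (p - 1) * c * ‖d‖ ^ 2 + k * (n + p - 2) := by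
  have hd0 : 0 < ‖d‖ := norm_pos_iff.2 hd
  have hg0 : g ≠ 0 := hg.ne
  have ha : g • d ≠ 0 := smul_ne_zero hg0 hd
  rw [trA_add_smul_innerBilin p ha]
  have e1 : inner ℝ d (‖g • d‖⁻¹ • (g • d)) = -‖d‖ := by
    rw [norm_smul, Real.norm_eq_abs, abs_of_neg hg, inner_smul_right, inner_smul_right,
      real_inner_self_eq_norm_sq]
    field_simp
  have e2 : ∀ h, (c • (innerBilin (Euc n) d).smulRight (innerBilin (Euc n) d)) h h =
      c * inner ℝ d h ^ 2 := fun h => by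
    simp only [smul_apply, ContinuousLinearMap.smulRight_apply, innerBilin_apply, smul_eq_mul]
    ring
  unfold trA
  simp only [e2, e1]
  rw [← Finset.mul_sum, sum_inner_sq]
  ring

/-- A nonnegative supersolution with small data that is bounded below by `μ` on a small ball near
the origin is positive at the origin. -/
theorem exists_pos_of_le_on_closedBall (n : ℕ) {p θ σ s μ : ℝ} (hp : 1 < p) (hθ : 0 < θ)
    (hσ : 0 < σ) (hs : 0 < s) (hμ : 0 < μ) :
    ∃ η > 0, ∀ v : Euc n → ℝ, ContinuousOn v (unitBall n) → (∀ x ∈ unitBall n, 0 ≤ v x) →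
      JetSuper p θ σ η η η (unitBall n) v → ∀ x₁ ∈ closedBall (0 : Euc n) (1 / 4),
      (∀ y ∈ closedBall x₁ s, μ ≤ v y) → 0 < v 0 := by
  have hn0 : (0 : ℝ) ≤ n := Nat.cast_nonneg n
  -- At distance at least s from the centre the radial term then exceeds the negative one, 4γ(n + p
  -- − 2), by at least 8γ, up to the common factor of the Gaussian.
  obtain ⟨γ, hγ⟩ : ∃ γ, γ = (n + p) / ((p - 1) * s ^ 2) := ⟨_, rfl⟩
  have hp1 : 0 < p - 1 := by linarith
  have hγ0 : 0 < γ := by rw [hγ]; positivity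
  have hγs : (p - 1) * γ * s ^ 2 = n + p := by rw [hγ]; field_simp
  obtain ⟨E, hE⟩ : ∃ E, E = Real.exp (-γ * (1 / 2) ^ 2) := ⟨_, rfl⟩
  have hE0 : 0 < E := hE ▸ Real.exp_pos _
  -- A₀ and A₁ bound the gradient norm of the barrier at a contact point; G bounds the operator from
  -- below there, while data G/(2H) keep the right-hand side at most G/2.
  obtain ⟨A₀, hA₀⟩ : ∃ A₀, A₀ = 2 * γ * (μ * E) * s := ⟨_, rfl⟩
  have hA₀0 : 0 < A₀ := by rw [hA₀]; positivity
  obtain ⟨A₁, hA₁⟩ : ∃ A₁, A₁ = γ * μ := ⟨_, rfl⟩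
  have hA₁0 : 0 < A₁ := by rw [hA₁]; positivity
  obtain ⟨H, hH⟩ : ∃ H, H = A₁ ^ (1 + θ) + A₁ ^ σ + 1 := ⟨_, rfl⟩
  have hH0 : 0 < H := by rw [hH]; positivity
  obtain ⟨G, hG⟩ : ∃ G, G = A₀ ^ θ * (8 * (μ * E) * γ) := ⟨_, rfl⟩
  have hG0 : 0 < G := by rw [hG]; positivity
  refine ⟨G / (2 * H), by positivity, fun v hvc hv0 hv x₁ hx₁ hball => ?_⟩
  by_contra hcon
  push Not at hcon
  have hx₁' : ‖x₁‖ ≤ 1 / 4 := by simpa using hx₁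
  -- Zero on the sphere of radius 1/2, below μ everywhere, positive at the origin. If v 0 ≤ 0, then
  -- v − w has a negative minimum, which lies neither on that sphere nor where v ≥ μ.
  set w : Euc n → ℝ := fun x => μ * (Real.exp (-γ * ‖x - x₁‖ ^ 2) - E) with hw
  have hwc : Continuous w := by fun_prop
  have hsub : closedBall x₁ (1 / 2) ⊆ unitBall n := by
    intro x hx
    have h1 : dist x x₁ ≤ 1 / 2 := hx
    have h2 := dist_triangle x x₁ 0
    rw [dist_zero_right x₁] at h2
    rw [unitBall, mem_ball]; linarith
  obtain ⟨y, hy, hymin⟩ := (isCompact_closedBall x₁ (1 / 2)).exists_isMinOn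
    ⟨x₁, mem_closedBall_self (by norm_num)⟩ (f := fun x => v x - w x)
    ((hvc.mono hsub).sub hwc.continuousOn)
  have hneg : v y - w y < 0 := by
    have h1 : v y - w y ≤ v 0 - w 0 := hymin (by
      rw [mem_closedBall, dist_zero_left]; linarith)
    have h2 : 0 < w 0 := by
      simp only [hw, zero_sub, norm_neg]
      refine mul_pos hμ (sub_pos.2 ?_)
      rw [hE, Real.exp_lt_exp]
      have : ‖x₁‖ ^ 2 ≤ (1 / 4) ^ 2 := pow_le_pow_left₀ (norm_nonneg _) hx₁' 2
      nlinarith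
    linarith
  have hyΩ := hsub hy
  obtain ⟨d, hd⟩ : ∃ d, y - x₁ = d := ⟨_, rfl⟩
  have hd1 : ‖d‖ ≤ 1 / 2 := by rw [← hd, ← dist_eq_norm]; exact hy
  obtain ⟨X₀, hX₀⟩ : ∃ X₀, X₀ = Real.exp (-γ * ‖d‖ ^ 2) := ⟨_, rfl⟩
  have hwy : w y = μ * (X₀ - E) := by simp only [hw, hd, hX₀]
  have hX₀1 : X₀ ≤ 1 := by
    rw [hX₀, Real.exp_le_one_iff]; nlinarith [sq_nonneg ‖d‖]
  have hX₀E : E ≤ X₀ := by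
    rw [hE, hX₀, Real.exp_le_exp]
    have : ‖d‖ ^ 2 ≤ (1 / 2) ^ 2 := pow_le_pow_left₀ (norm_nonneg _) hd1 2
    nlinarith
  have hds : s < ‖d‖ := by
    by_contra hle
    push Not at hle
    have h1 := hball y (by rw [mem_closedBall, dist_eq_norm, hd]; exact hle)
    nlinarith
  have hdlt : ‖d‖ < 1 / 2 := by
    refine lt_of_le_of_ne hd1 fun heq => ?_
    have h1 := hv0 y hyΩ
    rw [hwy, hX₀, heq, ← hE] at hneg
    linarith
  have hd0 : d ≠ 0 := norm_pos_iff.1 (hs.trans hds)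
  have hX₀0 : 0 < X₀ := hE0.trans_le hX₀E
  obtain ⟨g, hg⟩ : ∃ g, g = -(2 * γ * (μ * X₀)) := ⟨_, rfl⟩
  have hg0 : g < 0 := by rw [hg]; exact neg_lt_zero.2 (by positivity)
  have hjet := hv y hyΩ (g • d) (smul_ne_zero hg0.ne hd0)
    ((4 * γ ^ 2 * (μ * X₀)) • (innerBilin (Euc n) d).smulRight (innerBilin (Euc n) d) +
      (-(4 * γ * (μ * X₀))) • innerBilin (Euc n)) (by
    have hlim : Tendsto (fun x => x - y) (𝓝 y) (𝓝 0) := by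
      have : Continuous fun x : Euc n => x - y := by fun_prop
      simpa using this.tendsto y
    have hnear : closedBall x₁ (1 / 2) ∈ 𝓝 y :=
      mem_of_superset (Metric.isOpen_ball.mem_nhds (x := y) (s := ball x₁ (1 / 2))
        (by rwa [mem_ball, dist_eq_norm, hd])) ball_subset_closedBall
    filter_upwards [hlim.eventually (eventually_gaussian_ge d hγ0), hnear] with x h1 h2
    have h3 : v y - w y ≤ v x - w x := hymin h2
    have h4 : w x = μ * (Real.exp (-γ * ‖d + (x - y)‖ ^ 2) - E) := by
      have e : x - x₁ = d + (x - y) := by rw [← hd]; abel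
      simp only [hw, e]
    rw [hwy, h4] at h3
    have h5 := mul_le_mul_of_nonneg_left h1 hμ.le
    rw [← hX₀] at h5
    simp only [add_apply, smul_apply, ContinuousLinearMap.smulRight_apply, innerBilin_apply,
      smul_eq_mul, real_inner_self_eq_norm_sq, real_inner_smul_left]
    rw [hg]
    linarith)
  rw [trA_gaussian p hd0 hg0] at hjet
  have hnorm : ‖g • d‖ = 2 * γ * (μ * X₀) * ‖d‖ := by
    rw [norm_smul, Real.norm_eq_abs, abs_of_neg hg0, hg, neg_neg]
  have hnA₀ : A₀ ≤ ‖g • d‖ := by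
    rw [hnorm, hA₀]; gcongr
  have hnA₁ : ‖g • d‖ ≤ A₁ := by
    rw [hnorm, hA₁]
    have : 2 * γ * (μ * X₀) * ‖d‖ ≤ 2 * γ * (μ * 1) * (1 / 2) := by gcongr
    linarith
  have hr1 : ‖g • d‖ ^ (1 + θ) ≤ A₁ ^ (1 + θ) :=
    Real.rpow_le_rpow (norm_nonneg _) hnA₁ (by linarith)
  have hr2 : ‖g • d‖ ^ σ ≤ A₁ ^ σ := Real.rpow_le_rpow (norm_nonneg _) hnA₁ hσ.le
  have hr3 : A₀ ^ θ ≤ ‖g • d‖ ^ θ := Real.rpow_le_rpow hA₀0.le hnA₀ hθ.le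
  have htr : 8 * (μ * E) * γ ≤ (p - 1) * (4 * γ ^ 2 * (μ * X₀)) * ‖d‖ ^ 2 +
      -(4 * γ * (μ * X₀)) * (n + p - 2) := by
    have h1 : s ^ 2 ≤ ‖d‖ ^ 2 := pow_le_pow_left₀ hs.le hds.le 2
    have h2 : (p - 1) * γ * s ^ 2 ≤ (p - 1) * γ * ‖d‖ ^ 2 := by gcongr
    rw [hγs] at h2
    have h3 : 4 * γ * (μ * X₀) * (n + p) ≤ 4 * γ * (μ * X₀) * ((p - 1) * γ * ‖d‖ ^ 2) := by gcongr
    have h4 : 8 * (μ * E) * γ ≤ 8 * (μ * X₀) * γ := by gcongr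
    linarith
  have hLHS : G ≤ ‖g • d‖ ^ θ * ((p - 1) * (4 * γ ^ 2 * (μ * X₀)) * ‖d‖ ^ 2 +
      -(4 * γ * (μ * X₀)) * (n + p - 2)) := by
    rw [hG]
    exact mul_le_mul hr3 htr (by positivity) (by positivity)
  have hRHS : G / (2 * H) * ‖g • d‖ ^ (1 + θ) + G / (2 * H) * ‖g • d‖ ^ σ + G / (2 * H) ≤
      G / 2 := by
    have : G / (2 * H) * H = G / 2 := by field_simp
    have h1 : ‖g • d‖ ^ (1 + θ) + ‖g • d‖ ^ σ + 1 ≤ H := by rw [hH]; linarith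
    have h2 := mul_le_mul_of_nonneg_left h1 (by positivity : 0 ≤ G / (2 * H))
    linarith
  linarith

theorem JetSuper.mono {p θ σ b c d b' c' d' : ℝ} {Ω : Set (Euc n)} {v : Euc n → ℝ}
    (h : JetSuper p θ σ b c d Ω v) (hb : b ≤ b') (hc : c ≤ c') (hd : d ≤ d') :
    JetSuper p θ σ b' c' d' Ω v := by
  intro x hx a ha X hX
  refine (h x hx a ha X hX).trans ?_
  gcongr

/-- Flatness: solutions with small data that vanish at an interior minimum are small nearby. -/
theorem exists_flatness (n : ℕ) {p θ σ μ : ℝ} (hp : 1 < p) (hθ : 0 < θ) (hσ0 : 0 < σ)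
    (hσ : σ ≤ 1 + θ) (hμ : 0 < μ) :
    ∃ η > 0, ∀ v : Euc n → ℝ, ContinuousOn v (unitBall n) →
      (∀ x ∈ unitBall n, 0 ≤ v x ∧ v x ≤ 1) → v 0 = 0 →
      JetSuper p θ σ η η η (unitBall n) v →
      JetSuper p θ σ η η η (unitBall n) (fun y => -v y) →
      ∀ x ∈ ball (0 : Euc n) (1 / 4), v x ≤ μ := by
  obtain ⟨L, hL, hhol⟩ := exists_holder n hp hθ hσ
  -- L√s ≤ μ/2, and 1/4 is the range of the Hölder estimate.
  obtain ⟨s, hs⟩ : ∃ s, s = min (1 / 4) ((μ / (2 * L)) ^ 2) := ⟨_, rfl⟩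
  have hs0 : 0 < s := by rw [hs]; positivity
  have hs4 : s ≤ 1 / 4 := hs ▸ min_le_left _ _
  have hsμ : √s ≤ μ / (2 * L) := Real.sqrt_le_iff.2 ⟨by positivity, hs ▸ min_le_right _ _⟩
  obtain ⟨η, hη, hbar⟩ := exists_pos_of_le_on_closedBall n (σ := σ) hp hθ hσ0 hs0 (half_pos hμ)
  refine ⟨min 1 η, by positivity, fun v hvc hv01 hv0 hsup hsub x hx => ?_⟩
  by_contra hcon
  push Not at hcon
  have hm1 : min 1 η ≤ 1 := min_le_left _ _
  have hm2 : min 1 η ≤ η := min_le_right _ _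
  have hxc : x ∈ closedBall (0 : Euc n) (1 / 4) := ball_subset_closedBall hx
  have h0 := hbar v hvc (fun y hy => (hv01 y hy).1) (hsup.mono hm2 hm2 hm2) x hxc
    (fun y hy => by
      have h1 := hhol v hvc hv01 (hsup.mono hm1 hm1 hm1) (hsub.mono hm1 hm1 hm1) x hxc y
        (closedBall_subset_closedBall hs4 hy)
      have h2 : √‖x - y‖ ≤ √s := Real.sqrt_le_sqrt (by
        rw [← dist_eq_norm, dist_comm]; exact hy)
      have h3 : L * √‖x - y‖ ≤ L * (μ / (2 * L)) := by gcongr; exact h2.trans hsμ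
      have h4 : L * (μ / (2 * L)) = μ / 2 := by field_simp
      linarith)
  linarith

end Barrier

/-! ### Rescaling and geometric decay. -/

section Scaling

variable {n : ℕ}

theorem trA_smul_smul (p : ℝ) {q : ℝ} (hq : 0 < q) (c : ℝ) (a : Euc n)
    (X : Euc n →L[ℝ] Euc n →L[ℝ] ℝ) : trA p (q • a) (c • X) = c * trA p a X := by
  have e : ‖q • a‖⁻¹ • (q • a) = ‖a‖⁻¹ • a := by
    rw [norm_smul, Real.norm_eq_abs, abs_of_pos hq, smul_smul, mul_inv, mul_comm q⁻¹,
      mul_assoc, inv_mul_cancel₀ hq.ne', mul_one]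
  simp only [trA, e, smul_apply, smul_eq_mul, ← Finset.mul_sum]
  ring

/-- Gradients scale by m/r and Hessians by m/r²; multiplying by (r²/m)(m/r)^(−θ) restores the
normalized operator. -/
theorem JetSuper.rescale {p θ σ b c d : ℝ} {Ω Ω' : Set (Euc n)} {v : Euc n → ℝ}
    (h : JetSuper p θ σ b c d Ω v) (x₀ : Euc n) (k : ℝ) {r m : ℝ} (hr : 0 < r) (hm : 0 < m)
    (hΩ : ∀ y ∈ Ω', x₀ + r • y ∈ Ω) :
    JetSuper p θ σ (r * b) (c * (r ^ 2 / m * (m / r) ^ (σ - θ)))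
      (d * (r ^ 2 / m * (m / r) ^ (-θ))) Ω' (fun y => (v (x₀ + r • y) - k) / m) := by
  intro y hy a ha X hX
  obtain ⟨q, hq⟩ : ∃ q, q = m / r := ⟨_, rfl⟩
  have hq0 : 0 < q := by rw [hq]; positivity
  have hlim : Tendsto (fun z : Euc n => r⁻¹ • (z - x₀)) (𝓝 (x₀ + r • y)) (𝓝 y) := by
    have : Continuous fun z : Euc n => r⁻¹ • (z - x₀) := by fun_prop
    have h0 := this.tendsto (x₀ + r • y)
    rwa [add_sub_cancel_left, smul_smul, inv_mul_cancel₀ hr.ne', one_smul] at h0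
  have hjet := h (x₀ + r • y) (hΩ y hy) (q • a) (smul_ne_zero hq0.ne' ha) ((m / r ^ 2) • X) (by
    filter_upwards [hlim.eventually hX] with z hz
    have e1 : x₀ + r • r⁻¹ • (z - x₀) = z := by
      rw [smul_smul, mul_inv_cancel₀ hr.ne', one_smul]; abel
    obtain ⟨w, hw⟩ : ∃ w, z - (x₀ + r • y) = w := ⟨_, rfl⟩
    have e2 : r⁻¹ • (z - x₀) - y = r⁻¹ • w := by
      rw [← hw, ← sub_sub, smul_sub r⁻¹ _ (r • y), smul_smul r⁻¹ r y, inv_mul_cancel₀ hr.ne',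
        one_smul]
    have e3 : X (r⁻¹ • w) (r⁻¹ • w) = r⁻¹ * (r⁻¹ * X w w) := by
      simp only [map_smul, smul_apply, smul_eq_mul]
    rw [e1, e2, inner_smul_right, e3, le_div_iff₀ hm] at hz
    rw [hw, real_inner_smul_left, smul_apply, smul_apply, smul_eq_mul, hq]
    refine le_of_eq_of_le ?_ (le_sub_iff_add_le.1 hz)
    field_simp
    ring)
  rw [trA_smul_smul p hq0, norm_smul, Real.norm_eq_abs, abs_of_pos hq0,
    Real.mul_rpow hq0.le (norm_nonneg a), Real.mul_rpow hq0.le (norm_nonneg a),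
    Real.mul_rpow hq0.le (norm_nonneg a)] at hjet
  have hf0 : 0 < r ^ 2 / m * q ^ (-θ) := by positivity
  have key := mul_le_mul_of_nonneg_left hjet hf0.le
  have hqq : q ^ (-θ) * q ^ θ = 1 := by rw [← Real.rpow_add hq0]; simp
  have hq1 : q ^ (-θ) * q ^ (1 + θ) = q := by rw [← Real.rpow_add hq0]; simp
  have hq2 : q ^ (-θ) * q ^ σ = q ^ (σ - θ) := by rw [← Real.rpow_add hq0]; congr 1; ring
  have l1 : r ^ 2 / m * q ^ (-θ) * (q ^ θ * ‖a‖ ^ θ * (m / r ^ 2 * trA p a X)) =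
      ‖a‖ ^ θ * trA p a X := by
    have : r ^ 2 / m * (m / r ^ 2) = 1 := by field_simp
    calc _ = (q ^ (-θ) * q ^ θ) * (r ^ 2 / m * (m / r ^ 2)) * (‖a‖ ^ θ * trA p a X) := by ring
      _ = _ := by rw [hqq, this]; ring
  have l2 : r ^ 2 / m * q ^ (-θ) * (b * (q ^ (1 + θ) * ‖a‖ ^ (1 + θ)) + c * (q ^ σ * ‖a‖ ^ σ) + d) =
      r * b * ‖a‖ ^ (1 + θ) + c * (r ^ 2 / m * q ^ (σ - θ)) * ‖a‖ ^ σ +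
        d * (r ^ 2 / m * q ^ (-θ)) := by
    have : r ^ 2 / m * q = r := by rw [hq]; field_simp
    calc _ = (r ^ 2 / m * (q ^ (-θ) * q ^ (1 + θ))) * b * ‖a‖ ^ (1 + θ) +
          c * (r ^ 2 / m * (q ^ (-θ) * q ^ σ)) * ‖a‖ ^ σ + d * (r ^ 2 / m * q ^ (-θ)) := by ring
      _ = _ := by rw [hq1, hq2, this]
  rw [l1, l2, hq] at key
  exact key

/-- The left side is c r^(1+e)/m^e with m = M R^τ, hence at most t R^(1+e−τe), and τe ≤ 1 + e
exactly when e ≤ 1 + θ. Used with e = 1 + θ − σ for ϱ and with e = 1 + θ, the case of equality that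
fixes the exponent τ, for f. -/
theorem scaled_coefficient_le {θ e c M R t r : ℝ} (hθ : 0 < θ) (he0 : 0 < e) (he : e ≤ 1 + θ)
    (hc : c ≤ M ^ e) (hM : 0 < M) (hR : 0 < R) (hR1 : R ≤ 1) (ht : 0 < t) (ht1 : t ≤ 1)
    (hr : 0 < r) (hrt : r ≤ t * R) :
    c * (r ^ 2 / (M * R ^ (1 + 1 / (1 + θ))) *
      (M * R ^ (1 + 1 / (1 + θ)) / r) ^ (1 - e)) ≤ t := by
  obtain ⟨m, hm⟩ : ∃ m, m = M * R ^ (1 + 1 / (1 + θ)) := ⟨_, rfl⟩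
  have hm0 : 0 < m := by rw [hm]; positivity
  rw [← hm]
  have e1 : r ^ 2 / m * (m / r) ^ (1 - e) = r ^ (1 + e) / m ^ e := by
    rw [Real.div_rpow hm0.le hr.le, Real.rpow_sub hm0, Real.rpow_sub hr, Real.rpow_add hr,
      Real.rpow_one, Real.rpow_one]
    field_simp
  have e2 : m ^ e = M ^ e * R ^ ((1 + 1 / (1 + θ)) * e) := by
    rw [hm, Real.mul_rpow hM.le (by positivity), ← Real.rpow_mul hR.le]
  have h1 : r ^ (1 + e) ≤ t * R ^ ((1 + 1 / (1 + θ)) * e) := by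
    calc r ^ (1 + e) ≤ (t * R) ^ (1 + e) := Real.rpow_le_rpow hr.le hrt (by linarith)
      _ = t ^ (1 + e) * R ^ (1 + e) := Real.mul_rpow ht.le hR.le
      _ ≤ t ^ (1 : ℝ) * R ^ ((1 + 1 / (1 + θ)) * e) := by
        refine mul_le_mul (Real.rpow_le_rpow_of_exponent_ge ht ht1 (by linarith))
          (Real.rpow_le_rpow_of_exponent_ge hR hR1 ?_) (by positivity) (by positivity)
        have : 1 / (1 + θ) * e ≤ 1 := by
          rw [one_div_mul_eq_div, div_le_one (by linarith)]; exact he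
        linarith
      _ = _ := by rw [Real.rpow_one]
  have hMe : 0 < M ^ e := by positivity
  have hRe : 0 < R ^ ((1 + 1 / (1 + θ)) * e) := by positivity
  rw [e1, e2, ← mul_div_assoc, div_le_iff₀ (by positivity)]
  calc c * r ^ (1 + e) ≤ M ^ e * (t * R ^ ((1 + 1 / (1 + θ)) * e)) :=
        mul_le_mul hc h1 (by positivity) hMe.le
    _ = _ := by ring

/-- Geometric decay of the oscillation at an interior minimum. -/
theorem sub_le_of_isMinOn {p θ σ b c d η M δ t : ℝ} (hθ : 0 < θ) (hσ : σ < 1 + θ)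
    (hσθ : θ < σ)
    (hflat : ∀ v : Euc n → ℝ, ContinuousOn v (unitBall n) →
      (∀ x ∈ unitBall n, 0 ≤ v x ∧ v x ≤ 1) → v 0 = 0 →
      JetSuper p θ σ η η η (unitBall n) v →
      JetSuper p θ σ η η η (unitBall n) (fun y => -v y) →
      ∀ x ∈ ball (0 : Euc n) (1 / 4), v x ≤ (1 / 4 : ℝ) ^ (1 + 1 / (1 + θ)))
    {v : Euc n → ℝ} (hvc : ContinuousOn v (unitBall n))
    (hsup : JetSuper p θ σ b c d (unitBall n) v)
    (hsub : JetSuper p θ σ b c d (unitBall n) (fun y => -v y)) {x₀ : Euc n} (hδ : 0 < δ)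
    (hδ1 : δ ≤ 1) (hball : ball x₀ δ ⊆ unitBall n) (hmin : ∀ x ∈ ball x₀ δ, v x₀ ≤ v x)
    (hM : 0 < M) (hvM : ∀ x ∈ ball x₀ δ, v x - v x₀ ≤ M) (hb : 0 ≤ b) (hc : c ≤ M ^ (1 + θ - σ))
    (hd : d ≤ M ^ (1 + θ)) (ht : 0 < t) (ht1 : t ≤ 1) (htb : t * b ≤ η) (htη : t ≤ η) (k : ℕ) :
    ∀ x ∈ ball x₀ (δ * t * (1 / 4) ^ k),
      v x - v x₀ ≤ M * ((1 / 4 : ℝ) ^ k) ^ (1 + 1 / (1 + θ)) := by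
  induction k with
  | zero =>
    intro x hx
    simp only [pow_zero, mul_one, Real.one_rpow] at hx ⊢
    exact hvM x (ball_subset_ball (by nlinarith) hx)
  | succ k ih =>
    obtain ⟨R, hR⟩ : ∃ R, (1 / 4 : ℝ) ^ k = R := ⟨_, rfl⟩
    have hR0 : 0 < R := by rw [← hR]; positivity
    have hR1 : R ≤ 1 := by rw [← hR]; exact pow_le_one₀ (by norm_num) (by norm_num)
    rw [hR] at ih
    obtain ⟨r, hr⟩ : ∃ r, r = δ * t * R := ⟨_, rfl⟩
    obtain ⟨m, hm⟩ : ∃ m, m = M * R ^ (1 + 1 / (1 + θ)) := ⟨_, rfl⟩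
    rw [← hr, ← hm] at ih
    have hr0 : 0 < r := by rw [hr]; positivity
    have hm0 : 0 < m := by rw [hm]; positivity
    have hrt : r ≤ t * R := by
      rw [hr, mul_assoc]; exact mul_le_of_le_one_left (by positivity) hδ1
    have hrt' : r ≤ t := hrt.trans (mul_le_of_le_one_right ht.le hR1)
    have hrδ : r ≤ δ := by
      rw [hr, mul_assoc]
      exact mul_le_of_le_one_right hδ.le (mul_le_one₀ ht1 hR0.le hR1)
    have hmem : ∀ y ∈ unitBall n, x₀ + r • y ∈ ball x₀ r := fun y hy => by
      have hy1 : ‖y‖ < 1 := by simpa [unitBall] using hy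
      rw [mem_ball, dist_eq_norm, add_sub_cancel_left, norm_smul, Real.norm_eq_abs,
        abs_of_pos hr0]
      exact mul_lt_of_lt_one_right hr0 hy1
    have hmemδ : ∀ y ∈ unitBall n, x₀ + r • y ∈ ball x₀ δ := fun y hy =>
      ball_subset_ball hrδ (hmem y hy)
    have hmemΩ : ∀ y ∈ unitBall n, x₀ + r • y ∈ unitBall n := fun y hy => hball (hmemδ y hy)
    have hb' : r * b ≤ η := (mul_le_mul_of_nonneg_right hrt' hb).trans htb
    have hc' : c * (r ^ 2 / m * (m / r) ^ (σ - θ)) ≤ η := by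
      rw [hm, show σ - θ = 1 - (1 + θ - σ) by ring]
      exact (scaled_coefficient_le hθ (by linarith) (by linarith) hc hM hR0 hR1 ht ht1 hr0
        hrt).trans htη
    have hd' : d * (r ^ 2 / m * (m / r) ^ (-θ)) ≤ η := by
      rw [hm, show -θ = 1 - (1 + θ) by ring]
      exact (scaled_coefficient_le hθ (by linarith) le_rfl hd hM hR0 hR1 ht ht1 hr0
        hrt).trans htη
    -- Minimality gives the lower bound 0 and the induction hypothesis the upper bound 1.
    have hw := hflat (fun y => (v (x₀ + r • y) - v x₀) / m)
      ((((hvc.comp (by fun_prop) hmemΩ).sub continuousOn_const)).div_const m)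
      (fun y hy => ⟨div_nonneg (sub_nonneg.2 (hmin _ (hmemδ y hy))) hm0.le,
        (div_le_one hm0).2 (ih _ (hmem y hy))⟩) (by simp)
      ((hsup.rescale x₀ (v x₀) hr0 hm0 hmemΩ).mono hb' hc' hd') (by
        have h1 := (hsub.rescale x₀ (-v x₀) hr0 hm0 hmemΩ).mono hb' hc' hd'
        convert h1 using 2 with y
        ring)
    intro x hx
    have hx1 : ‖x - x₀‖ < r * (1 / 4) := by
      rw [mem_ball, dist_eq_norm, pow_succ, hR] at hx
      rw [hr]; linarith
    have h2 := hw (r⁻¹ • (x - x₀)) (by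
      rw [mem_ball, dist_zero_right, norm_smul, norm_inv, Real.norm_eq_abs, abs_of_pos hr0,
        inv_mul_lt_iff₀ hr0]
      exact hx1)
    simp only [smul_smul, mul_inv_cancel₀ hr0.ne', one_smul, add_sub_cancel] at h2
    rw [div_le_iff₀ hm0] at h2
    refine h2.trans (le_of_eq ?_)
    rw [hm, pow_succ, hR, Real.mul_rpow hR0.le (by norm_num)]
    ring

theorem norm_le_supNorm {F : Type*} [NormedAddCommGroup F] {g : Euc n → F}
    (hg : ∃ M, ∀ x ∈ unitBall n, ‖g x‖ ≤ M) {x : Euc n} (hx : x ∈ unitBall n) :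
    ‖g x‖ ≤ supNorm g := by
  obtain ⟨M, hM⟩ := hg
  exact le_ciSup (f := fun x : unitBall n => ‖g x‖) ⟨M, by rintro _ ⟨y, rfl⟩; exact hM y y.2⟩
    ⟨x, hx⟩

theorem exists_norm_le_of_continuousOn_closure {F : Type*} [NormedAddCommGroup F] {g : Euc n → F}
    (hg : ContinuousOn g (closure (unitBall n))) : ∃ M, ∀ x ∈ unitBall n, ‖g x‖ ≤ M := by
  have hc : IsCompact (closure (unitBall n)) := Metric.isBounded_ball.isCompact_closure
  obtain ⟨M, hM⟩ := hc.exists_bound_of_continuousOn hg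
  exact ⟨M, fun x hx => hM x (subset_closure hx)⟩

theorem supNorm_nonneg {F : Type*} [NormedAddCommGroup F] (g : Euc n → F) : 0 ≤ supNorm g :=
  Real.iSup_nonneg fun _ => norm_nonneg _

/-- If δ > 1, both x₀ ± e would lie in the unit ball for a unit vector e. Dimension 0 is excluded:
every ball there is a single point. -/
theorem radius_le_one [Nontrivial (Euc n)] {x₀ : Euc n} {δ : ℝ}
    (h : ball x₀ δ ⊆ unitBall n) : δ ≤ 1 := by
  by_contra hcon
  push Not at hcon
  obtain ⟨e, he⟩ := exists_norm_eq (Euc n) (zero_le_one (α := ℝ))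
  have h1 : ∀ w : Euc n, ‖w‖ = 1 → ‖x₀ + w‖ < 1 := fun w hw => by
    have : x₀ + w ∈ unitBall n := h (by
      rw [mem_ball, dist_eq_norm, add_sub_cancel_left, hw]; exact hcon)
    simpa [unitBall] using this
  have h2 := h1 e he
  have h3 := h1 (-e) (by rwa [norm_neg])
  have h4 : (2 : ℝ) • e = (x₀ + e) - (x₀ + -e) := by rw [two_smul]; abel
  have h5 := norm_sub_le (x₀ + e) (x₀ + -e)
  rw [← h4, norm_smul, he, Real.norm_eq_abs, abs_two] at h5
  linarith

end Scaling

end NormalizedPLaplace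

/-! ### The regularity estimate. -/

open NormalizedPLaplace

theorem mainTheorem2 (n : ℕ) (p θ σ K : ℝ) (hp : 1 < p) (hθ : 0 < θ)
    (hσ : θ < σ ∧ σ < 1 + θ) :
    ∃ C : ℝ, 0 < C ∧
      ∀ (B : NormalizedPLaplace.Euc n → NormalizedPLaplace.Euc n)
        (ϱ f u : NormalizedPLaplace.Euc n → ℝ) (κ : ℝ),
        (κ = 0 ∨ κ = 1) →
        ContinuousOn B (closure (NormalizedPLaplace.unitBall n)) →
        NormalizedPLaplace.supNorm B ≤ K →
        ContinuousOn ϱ (closure (NormalizedPLaplace.unitBall n)) →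
        ContinuousOn f (NormalizedPLaplace.unitBall n) →
        NormalizedPLaplace.BoundedOnBall f →
        NormalizedPLaplace.BoundedOnBall u →
        NormalizedPLaplace.IsViscositySolution κ p θ σ B ϱ f (NormalizedPLaplace.unitBall n) u →
        ∀ (x₀ : NormalizedPLaplace.Euc n) (δ : ℝ), 0 < δ →
          Metric.ball x₀ δ ⊆ NormalizedPLaplace.unitBall n →
          IsExtrOn u (Metric.ball x₀ δ) x₀ →
          ∀ r : ℝ, 0 < r → r < 1 / 2 →
            ∀ x ∈ Metric.ball x₀ r ∩ NormalizedPLaplace.unitBall n,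
              |u x - u x₀| ≤
                C * (NormalizedPLaplace.supNorm u
                    + NormalizedPLaplace.supNorm ϱ ^ (1 / (1 + θ - σ))
                    + NormalizedPLaplace.supNorm f ^ (1 / (1 + θ)))
                  * (r / δ) ^ (1 + 1 / (1 + θ)) := by
  have hσ0 : 0 < σ := hθ.trans hσ.1
  obtain ⟨η, hη, hflat⟩ := exists_flatness n (p := p) (θ := θ) (σ := σ)
    (μ := (1 / 4 : ℝ) ^ (1 + 1 / (1 + θ))) hp hθ hσ0 hσ.2.le (by positivity)
  obtain ⟨t, ht⟩ : ∃ t, t = min 1 (η / (1 + |K|)) := ⟨_, rfl⟩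
  have ht0 : 0 < t := by rw [ht]; positivity
  have ht1 : t ≤ 1 := ht ▸ min_le_left _ _
  have htK : t * (1 + |K|) ≤ η := by
    have : t ≤ η / (1 + |K|) := ht ▸ min_le_right _ _
    rwa [le_div_iff₀ (by positivity)] at this
  have hK0 := abs_nonneg K
  obtain ⟨τ, hτ⟩ : ∃ τ, τ = 1 + 1 / (1 + θ) := ⟨_, rfl⟩
  have hτ0 : 0 < τ := by rw [hτ]; positivity
  -- The 2 comes from the normalization M = 2A, 1/t from starting the decay at radius δt, and 4 from
  -- rounding r/(δt) up to a power of 1/4.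
  refine ⟨2 * (4 / t) ^ τ, by positivity, ?_⟩
  intro B ϱ f u κ _ hB hBK hϱ _ hf hu hsol x₀ δ hδ hball hext r hr _ x ⟨hxr, hx⟩
  rw [← hτ]
  rw [← hτ] at hflat
  obtain ⟨A, hA⟩ : ∃ A, A = supNorm u + supNorm ϱ ^ (1 / (1 + θ - σ))
    + supNorm f ^ (1 / (1 + θ)) := ⟨_, rfl⟩
  have hSϱ := supNorm_nonneg ϱ
  have hSf := supNorm_nonneg f
  have hSu := supNorm_nonneg u
  have hAϱ : 0 ≤ supNorm ϱ ^ (1 / (1 + θ - σ)) := by positivity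
  have hAf : 0 ≤ supNorm f ^ (1 / (1 + θ)) := by positivity
  have hA0 : 0 ≤ A := by rw [hA]; positivity
  rw [← hA]
  have hx₀ : x₀ ∈ unitBall n := hball (Metric.mem_ball_self hδ)
  have hbu : ∀ y ∈ unitBall n, |u y| ≤ supNorm u := fun y hy => norm_le_supNorm (g := u) hu hy
  have htriv : ∀ y ∈ unitBall n, |u y - u x₀| ≤ 2 * A := fun y hy => by
    have h1 := abs_sub (u y) (u x₀)
    have := hbu y hy
    have := hbu x₀ hx₀
    linarith
  have hrt : (4 / t) ^ τ * (r / δ) ^ τ = (4 * (r / (δ * t))) ^ τ := by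
    rw [← Real.mul_rpow (by positivity) (by positivity)]
    congr 1; field_simp
  have hgoal : 2 * (4 / t) ^ τ * A * (r / δ) ^ τ = 2 * A * (4 * (r / (δ * t))) ^ τ := by
    rw [← hrt]; ring
  rw [hgoal]
  rcases le_or_gt (δ * t) r with hbig | hsmall
  · refine (htriv x hx).trans (le_mul_of_one_le_right (by positivity) ?_)
    refine Real.one_le_rpow ?_ hτ0.le
    have : 1 ≤ r / (δ * t) := (one_le_div (by positivity)).2 hbig
    linarith
  -- The decay lemma needs M = 2A > 0; if A = 0, then u vanishes on the ball.
  rcases hA0.eq_or_lt with hAz | hApos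
  · have := htriv x hx
    rw [← hAz] at this ⊢
    simpa using this
  rcases subsingleton_or_nontrivial (Euc n) with hsing | hnt
  · rw [Subsingleton.elim x x₀, sub_self, abs_zero]; positivity
  have hδ1 : δ ≤ 1 := radius_le_one hball
  have hxδ : x ∈ Metric.ball x₀ δ := Metric.ball_subset_ball
    (hsmall.le.trans (mul_le_of_le_one_right hδ.le ht1)) hxr
  have hBb : ∀ y ∈ unitBall n, ‖B y‖ ≤ |K| := fun y hy =>
    ((norm_le_supNorm (exists_norm_le_of_continuousOn_closure hB) hy).trans hBK).trans
      (le_abs_self K)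
  have hϱb : ∀ y ∈ unitBall n, |ϱ y| ≤ supNorm ϱ := fun y hy =>
    norm_le_supNorm (exists_norm_le_of_continuousOn_closure hϱ) hy
  have hfb : ∀ y ∈ unitBall n, |f y| ≤ supNorm f := fun y hy => norm_le_supNorm (g := f) hf hy
  have hsup := hsol.2.2.jetSuper hBb hϱb hfb
  have hsub := hsol.2.1.jetSuper_neg hBb hϱb hfb
  have hpow : ∀ S e : ℝ, 0 ≤ S → 0 < e → S ^ (1 / e) ≤ A → S ≤ (2 * A) ^ e := by
    intro S e hS he hSA
    calc S = (S ^ (1 / e)) ^ e := by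
          rw [← Real.rpow_mul hS, one_div_mul_cancel he.ne', Real.rpow_one]
      _ ≤ (2 * A) ^ e := Real.rpow_le_rpow (by positivity) (by linarith) he.le
  have hcϱ := hpow _ (1 + θ - σ) hSϱ (by linarith [hσ.2]) (by linarith)
  have hcf := hpow _ (1 + θ) hSf (by linarith) (by linarith)
  obtain ⟨k, hk1, hk2⟩ := exists_nat_pow_near_of_lt_one (x := r / (δ * t)) (y := 1 / 4)
    (by positivity) ((div_le_one (by positivity)).2 hsmall.le) (by norm_num) (by norm_num)
  have hxk : x ∈ Metric.ball x₀ (δ * t * (1 / 4) ^ k) := Metric.ball_subset_ball (by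
    rw [div_le_iff₀ (by positivity)] at hk2; linarith) hxr
  have hkτ : 2 * A * ((1 / 4 : ℝ) ^ k) ^ τ ≤ 2 * A * (4 * (r / (δ * t))) ^ τ := by
    gcongr
    rw [pow_succ] at hk1; linarith
  refine le_trans ?_ hkτ
  rw [hτ] at hflat ⊢
  rcases hext with hmin | hmax
  · rw [abs_of_nonneg (sub_nonneg.2 (hmin hxδ))]
    exact sub_le_of_isMinOn hθ hσ.2 hσ.1 hflat hsol.1 hsup hsub hδ hδ1 hball
      (fun y hy => hmin hy) (by positivity)
      (fun y hy => (le_abs_self _).trans (htriv y (hball hy))) hK0 hcϱ hcf ht0 ht1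
      (by linarith) (by nlinarith) k x hxk
  · rw [abs_sub_comm, abs_of_nonneg (sub_nonneg.2 (hmax hxδ))]
    have := sub_le_of_isMinOn hθ hσ.2 hσ.1 (v := fun y => -u y) hflat hsol.1.neg hsub (by simpa using hsup) hδ hδ1
      hball (fun y hy => neg_le_neg (hmax hy)) (by positivity : 0 < 2 * A)
      (fun y hy => by
        have h1 := (neg_le_abs _).trans (htriv y (hball hy))
        linarith) hK0 hcϱ hcf ht0 ht1
      (by linarith) (by nlinarith) k x hxk
    linarith
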